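/- Throughout, a digraph is finite, has no loops and no parallel arcs, but may contain digons (pairs of arcs in opposite directions between the same two vertices); $\log$ is the logarithm to base $2$. The inversion of a set $X\subseteq V(D)$ in a digraph $D$ reverses all arcs of $D$ that have both endvertices in $X$. A digraph is $k$-arc-strong if for every partition $(V_1,V_2)$ of its vertex set into two nonempty sets there are at least $k$ arcs with tail in $V_1$ and head in $V_2$. A digraph is $2k$-edge-connected if its underlying multigraph (every arc is replaced by an edge, so that a digon becomes two parallel edges) has, for every partition of the vertex set into two nonempty sets, at least $2k$ edges with one endvertex in each of the two sets. For a digraph $D$, let $\mathrm{sinv}'_k(D)$ be the minimum number of inversions, performed one after another, that transform $D$ into a $k$-arc-strong digraph ($+\infty$ if this is impossible), and let $$\mathrm{sinv}'_k(n)=\max\{\mathrm{sinv}'_k(D) : D \text{ is a } 2k\text{-edge-connected digraph on } n \text{ vertices}\}.$$ **Theorem.** For all positive integers $k,n$ with $n\ge k+2$, the maximum $\mathrm{sinv}'_k(n)$ exists and is finite, and $$\tfrac12\log(n-k+1)\;\le\;\mathrm{sinv}'_k(n)\;\le\;\log n+4k-3 .$$ -/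

import Mathlib

namespace ArcInversion

universe u

/-- A digraph without loops. (Mathlib's `Digraph` has no parallel arcs but allows loops;
digons, i.e. pairs of opposite arcs, are allowed.) -/
def IsLoopless {V : Type u} (D : Digraph V) : Prop :=
  ∀ v : V, ¬ D.Adj v v

/-- The underlying multigraph `UG(D)`: every arc `(a, b)` of `D` is an edge with ends `a` and `b`.
A digon of `D` gives two parallel edges. -/
def underlyingMultigraph {V : Type u} (D : Digraph V) : Graph V (V × V) where
  vertexSet := Set.univ
  IsLink e x y := D.Adj e.1 e.2 ∧ (e = (x, y) ∨ e = (y, x))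
  isLink_symm := fun _ _ => ⟨fun _ _ h => ⟨h.1, h.2.symm⟩⟩
  eq_or_eq_of_isLink_of_isLink := by
    rintro e x y v w ⟨_, rfl | rfl⟩ ⟨_, h | h⟩ <;> simp_all
  left_mem_of_isLink := fun _ _ _ _ => Set.mem_univ _

/-- A multigraph is `k`-edge-connected if for every partition of its vertex set into two nonempty
sets, at least `k` edges have one end in each of the two sets. -/
def IsEdgeConnected {α β : Type*} (k : ℕ) (G : Graph α β) : Prop :=
  ∀ V₁ V₂ : Set α, V₁.Nonempty → V₂.Nonempty → Disjoint V₁ V₂ → V₁ ∪ V₂ = G.vertexSet →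
    (k : ℕ∞) ≤ {e : β | ∃ x ∈ V₁, ∃ y ∈ V₂, G.IsLink e x y}.encard

/-- A digraph is `k`-arc-strong if for every partition `(V₁, V₂)` of its vertex set into two
nonempty sets, at least `k` arcs have their tail in `V₁` and their head in `V₂`. -/
def IsArcStrong {V : Type u} (k : ℕ) (D : Digraph V) : Prop :=
  ∀ V₁ V₂ : Set V, V₁.Nonempty → V₂.Nonempty → Disjoint V₁ V₂ → V₁ ∪ V₂ = Set.univ →
    (k : ℕ∞) ≤ {a : V × V | a.1 ∈ V₁ ∧ a.2 ∈ V₂ ∧ D.Adj a.1 a.2}.encard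

/-- The inversion of a set `X` of vertices: all arcs with both endvertices in `X` are reversed. -/
def invert {V : Type u} (D : Digraph V) (X : Set V) : Digraph V where
  Adj x y := ((x ∈ X ∧ y ∈ X) ∧ D.Adj y x) ∨ (¬ (x ∈ X ∧ y ∈ X) ∧ D.Adj x y)

/-- Inversion of the members of a finite family of vertex sets, one after another. -/
def invertFamily {V : Type u} (D : Digraph V) (Xs : List (Set V)) : Digraph V :=
  Xs.foldl invert D

/-- The `k`-arc-strong inversion number of `D`: the minimum number of inversions that transform
`D` into a `k`-arc-strong digraph (`⊤` if there is no such family). -/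
noncomputable def arcStrongInversionNumber {V : Type u} (k : ℕ) (D : Digraph V) : ℕ∞ :=
  ⨅ (Xs : List (Set V)) (_ : IsArcStrong k (invertFamily D Xs)), (Xs.length : ℕ∞)

/-- The `k`-arc-strong inversion numbers of the `2k`-edge-connected digraphs of order `n`. -/
def inversionNumbers (k n : ℕ) : Set ℕ∞ :=
  {s | ∃ D : Digraph (Fin n), IsLoopless D ∧ IsEdgeConnected (2 * k) (underlyingMultigraph D) ∧
    arcStrongInversionNumber k D = s}

/-- The supremum of the `k`-arc-strong inversion numbers of the `2k`-edge-connected digraphs of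
order `n`. -/
noncomputable def maxArcStrongInversionNumber (k n : ℕ) : ℕ∞ :=
  sSup (inversionNumbers k n)

end ArcInversion

/-!
Why the theorem is true.

*Upper bound.* Inverting `t` sets amounts to giving each vertex `v` a vector `x v` over `ZMod 2` of
dimension `t`, namely its membership pattern; the arc `uv` ends up reversed if and only if
`x u ⬝ᵥ x v = 1` (`invertFamily_adj`, `flips_ofFn`). So it suffices to find a target orientation
and vectors that realise it.

The target comes from Nash-Williams' orientation theorem, in a version that keeps digons as digons
(`exists_arcStrong_orientation`). It rests on a weak odd-vertex pairing theorem
(`exists_odd_pairing`): a `2k`-edge-connected multigraph `G` has a companion `M` with the same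
degree parities and with cuts smaller by at least `2k`. This is proved by deleting superfluous
edges, and by splitting off vertices of degree `2k` (Lovász) when there are none. Every balanced
orientation of the non-digon part of `G` together with `M` is then good on `G`.

To realise it in dimension `log n + 4k - 3`, the multigraph is first made edge-minimal, so that
each edge lies in a tight cut. The vectors are chosen greedily
(`exists_vectors_of_card_conflicts_lt`), maintaining that the earlier neighbours of each vertex
have independent vectors. The vertices are ordered along a hierarchy of tight sets
(`exists_tight_hierarchy`), so that a vertex with many earlier neighbours causes few conflicts
(`exists_vectors_of_hierarchy`).

*Lower bound.* Take `m` hubs with `m ^ 2 ≤ n - k + 1 < (m + 1) ^ 2`, a sink attached to hubs `i`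
and `j` for each ordered pair of distinct hubs, further such sinks to reach `n - k + 1` vertices,
and `k - 1` vertices joined to everything by digons. After inversions that make this digraph
`k`-arc-strong, the membership patterns of the hubs are distinct and nonzero (`card_hubs_lt`), so
`m + 1 ≤ 2 ^ s` and `n - k + 1 ≤ 4 ^ s`. The case `n = k + 2`, where there is room for one hub
only, is treated separately.
-/

namespace ArcInversion

/-! ### Cuts of multigraphs -/

section Cuts

variable {V : Type*}

/-- The multigraph `G` has all its edges inside `U`. -/
def Within (U : Finset V) (G : Multiset (Sym2 V)) : Prop := ∀ e ∈ G, ∀ a ∈ e, a ∈ U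

lemma within_cons {U : Finset V} {a b : V} {G : Multiset (Sym2 V)} :
    Within U (s(a, b) ::ₘ G) ↔ (a ∈ U ∧ b ∈ U) ∧ Within U G := by
  simp [Within]

lemma Within.mono {U W : Finset V} {G : Multiset (Sym2 V)} (h : Within U G) (hUW : U ⊆ W) :
    Within W G := fun e he a ha => hUW (h e he a ha)

variable [DecidableEq V]

/-- The indicator of an edge `e` having exactly one end in `X`. -/
def crossing (X : Finset V) : Sym2 V → ℕ :=
  Sym2.lift ⟨fun a b => if (a ∈ X ↔ b ∈ X) then 0 else 1, fun a b => by simp only [iff_comm]⟩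

@[simp]
lemma crossing_mk (X : Finset V) (a b : V) :
    crossing X s(a, b) = if (a ∈ X ↔ b ∈ X) then 0 else 1 := rfl

/-- The size of the cut between `X` and its complement in a multigraph, which is encoded as the
multiset of its edges. In particular `cutSize G {v}` is the degree of `v`, loops not counted. -/
def cutSize (G : Multiset (Sym2 V)) (X : Finset V) : ℕ := (G.map (crossing X)).sum

@[simp]
lemma cutSize_zero (X : Finset V) : cutSize 0 X = 0 := by simp [cutSize]

@[simp]
lemma cutSize_cons (e : Sym2 V) (G : Multiset (Sym2 V)) (X : Finset V) :
    cutSize (e ::ₘ G) X = crossing X e + cutSize G X := by simp [cutSize]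

@[simp]
lemma cutSize_add (G H : Multiset (Sym2 V)) (X : Finset V) :
    cutSize (G + H) X = cutSize G X + cutSize H X := by simp [cutSize]

/-- Every proper nonempty part of `U` is joined to the rest by at least `k` edges of `G`. -/
def EdgeConnOn (k : ℕ) (U : Finset V) (G : Multiset (Sym2 V)) : Prop :=
  ∀ X ⊆ U, X.Nonempty → X ≠ U → k ≤ cutSize G X

lemma cutSize_submodular (G : Multiset (Sym2 V)) (X Y : Finset V) :
    cutSize G (X ∩ Y) + cutSize G (X ∪ Y) ≤ cutSize G X + cutSize G Y := by
  induction G using Multiset.induction with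
  | empty => simp
  | cons e G ih =>
    have : crossing (X ∩ Y) e + crossing (X ∪ Y) e ≤ crossing X e + crossing Y e := by
      induction e using Sym2.ind with
      | _ a b =>
        by_cases h1 : a ∈ X <;> by_cases h2 : b ∈ X <;> by_cases h3 : a ∈ Y <;>
          by_cases h4 : b ∈ Y <;> simp [h1, h2, h3, h4]
    simp only [cutSize_cons]; omega

lemma cutSize_posimodular (G : Multiset (Sym2 V)) (X Y : Finset V) :
    cutSize G (X \ Y) + cutSize G (Y \ X) ≤ cutSize G X + cutSize G Y := by
  induction G using Multiset.induction with
  | empty => simp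
  | cons e G ih =>
    have : crossing (X \ Y) e + crossing (Y \ X) e ≤ crossing X e + crossing Y e := by
      induction e using Sym2.ind with
      | _ a b =>
        by_cases h1 : a ∈ X <;> by_cases h2 : b ∈ X <;> by_cases h3 : a ∈ Y <;>
          by_cases h4 : b ∈ Y <;> simp [h1, h2, h3, h4]
    simp only [cutSize_cons]; omega

lemma even_cutSize_of_disjoint (G : Multiset (Sym2 V)) {X Y : Finset V} (h : Disjoint X Y) :
    Even (cutSize G X + cutSize G Y + cutSize G (X ∪ Y)) := by
  induction G using Multiset.induction with
  | empty => simp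
  | cons e G ih =>
    have : Even (crossing X e + crossing Y e + crossing (X ∪ Y) e) := by
      induction e using Sym2.ind with
      | _ a b =>
        have ha : a ∈ X → a ∉ Y := fun h1 h2 => (Finset.disjoint_left.1 h) h1 h2
        have hb : b ∈ X → b ∉ Y := fun h1 h2 => (Finset.disjoint_left.1 h) h1 h2
        by_cases h1 : a ∈ X <;> by_cases h2 : b ∈ X <;> by_cases h3 : a ∈ Y <;>
          by_cases h4 : b ∈ Y <;> simp_all
    simp only [cutSize_cons]
    rw [Nat.even_iff] at *; omega

lemma cutSize_sdiff_of_within {U : Finset V} {G : Multiset (Sym2 V)} (hG : Within U G)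
    (X : Finset V) : cutSize G (U \ X) = cutSize G X := by
  induction G using Multiset.induction with
  | empty => simp
  | cons e G ih =>
    induction e using Sym2.ind with
    | _ a b =>
      obtain ⟨⟨ha, hb⟩, hG⟩ := within_cons.1 hG
      simp [ih hG, ha, hb, not_iff_not]

lemma cutSize_eq_zero_of_within {U : Finset V} {G : Multiset (Sym2 V)} (hG : Within U G)
    {X : Finset V} (hX : X ∩ U = ∅ ∨ U ⊆ X) : cutSize G X = 0 := by
  induction G using Multiset.induction with
  | empty => simp
  | cons e G ih =>
    induction e using Sym2.ind with
    | _ a b =>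
      obtain ⟨⟨ha, hb⟩, hG⟩ := within_cons.1 hG
      have : a ∈ X ↔ b ∈ X := by
        rcases hX with hX | hX
        · have h : ∀ c ∈ U, c ∉ X := fun c hc hcX => by
            have := Finset.mem_inter.2 ⟨hcX, hc⟩
            rw [hX] at this; simp at this
          simp [h a ha, h b hb]
        · simp [hX ha, hX hb]
      simp [ih hG, this]

/-- If the vertex `s` is outside `U` and all its neighbours are in `X`, then moving `s` to the
side of `X` saves the whole degree of `s`. -/
lemma cutSize_eq_add_of_neighbors_mem {U X : Finset V} {s : V} {G : Multiset (Sym2 V)}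
    (hs : s ∉ U) (hG : Within (insert s U) G) (hX : X ⊆ U)
    (h : ∀ u, s(s, u) ∈ G → u ≠ s → u ∈ X) :
    cutSize G X = cutSize G (U \ X) + cutSize G {s} := by
  induction G using Multiset.induction with
  | empty => simp
  | cons e G ih =>
    induction e using Sym2.ind with
    | _ a b =>
      obtain ⟨⟨ha, hb⟩, hG⟩ := within_cons.1 hG
      have := ih hG fun u hu => h u (Multiset.mem_cons_of_mem hu)
      have hsX : s ∉ X := fun h => hs (hX h)
      have key : crossing X s(a, b) = crossing (U \ X) s(a, b) + crossing {s} s(a, b) := by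
        by_cases has : a = s
        · subst has
          by_cases hbs : b = a
          · subst hbs; simp
          · have hbX : b ∈ X := h b (Multiset.mem_cons_self _ _) hbs
            simp [hsX, hs, hbX, hbs]
        · by_cases hbs : b = s
          · subst hbs
            have haX : a ∈ X := h a (by rw [Sym2.eq_swap]; exact Multiset.mem_cons_self _ _) has
            simp [hsX, hs, haX, has]
          · have ha' := Finset.mem_of_mem_insert_of_ne ha has
            have hb' := Finset.mem_of_mem_insert_of_ne hb hbs
            simp [ha', hb', has, hbs, not_iff_not]
      simp only [cutSize_cons]; omega

lemma exists_eq_cons_of_cutSize_singleton_ne_zero {s : V} {G : Multiset (Sym2 V)}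
    (h : cutSize G {s} ≠ 0) : ∃ v H, v ≠ s ∧ G = s(s, v) ::ₘ H := by
  induction G using Multiset.induction with
  | empty => simp at h
  | cons e G ih =>
    by_cases h0 : cutSize G {s} = 0
    · induction e using Sym2.ind with
      | _ a b =>
        simp only [cutSize_cons, h0, crossing_mk, Finset.mem_singleton] at h
        by_cases ha : a = s
        · subst ha
          refine ⟨b, G, ?_, rfl⟩
          rintro rfl; simp at h
        · by_cases hb : b = s
          · subst hb
            exact ⟨a, G, ha, by rw [Sym2.eq_swap]⟩
          · simp [ha, hb] at h
    · obtain ⟨v, H, hv, rfl⟩ := ih h0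
      exact ⟨v, e ::ₘ H, hv, Multiset.cons_swap _ _ _⟩

end Cuts

/-! ### Splitting off and odd-vertex pairings -/

section Splitting

variable {V : Type*} [DecidableEq V]

lemma cutSize_split_le (s u v : V) (H : Multiset (Sym2 V)) (X : Finset V) :
    cutSize (s(v, u) ::ₘ H) X ≤ cutSize (s(s, v) ::ₘ s(s, u) ::ₘ H) X := by
  by_cases h1 : s ∈ X <;> by_cases h2 : u ∈ X <;> by_cases h3 : v ∈ X <;>
    simp [h1, h2, h3] <;> omega

lemma even_cutSize_split (s u v : V) (H : Multiset (Sym2 V)) (X : Finset V) :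
    Even (cutSize (s(v, u) ::ₘ H) X + cutSize (s(s, v) ::ₘ s(s, u) ::ₘ H) X) := by
  by_cases h1 : s ∈ X <;> by_cases h2 : u ∈ X <;> by_cases h3 : v ∈ X <;>
    simp [h1, h2, h3, ← two_mul, Nat.even_iff] <;> omega

/-- One step of Lovász's splitting-off theorem: at a vertex `s` of even positive degree, some pair
of edges `sv`, `su` can be replaced by `vu` without destroying `2k`-edge-connectivity in `U`.

A pair cannot be split off only if a dangerous set (a proper subset of `U` with cut at most
`2k + 1`) contains both `u` and `v`. A maximal dangerous set `X` containing `v` misses some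
neighbour `u` of `s`, and a dangerous set `Y` containing `u` and `v` then violates
posimodularity, up to parity. -/
lemma exists_split {k : ℕ} {U : Finset V} {s : V} {G : Multiset (Sym2 V)} (hs : s ∉ U)
    (hG : Within (insert s U) G) (hconn : EdgeConnOn (2 * k) U G) (heven : Even (cutSize G {s}))
    (hpos : cutSize G {s} ≠ 0) :
    ∃ u v H, u ≠ s ∧ v ≠ s ∧ G = s(s, v) ::ₘ s(s, u) ::ₘ H ∧
      EdgeConnOn (2 * k) U (s(v, u) ::ₘ H) := by
  obtain ⟨v, G₁, hvs, rfl⟩ := exists_eq_cons_of_cutSize_singleton_ne_zero hpos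
  set G := s(s, v) ::ₘ G₁ with hGdef
  have hvU : v ∈ U := Finset.mem_of_mem_insert_of_ne (within_cons.1 hG).1.2 hvs
  by_contra hcon
  push Not at hcon
  have key : ∀ u, u ≠ s → s(s, u) ∈ G₁ →
      ∃ X ⊆ U, X ≠ U ∧ v ∈ X ∧ u ∈ X ∧ cutSize G X ≤ 2 * k + 1 := by
    intro u hus hu
    obtain ⟨H, rfl⟩ := Multiset.exists_cons_of_mem hu
    have := hcon u v H hus hvs rfl
    simp only [EdgeConnOn, not_forall] at this
    obtain ⟨X, hXU, hXne, hXne', hlt⟩ := this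
    have hge := hconn X hXU hXne hXne'
    have hsX : s ∉ X := fun h => hs (hXU h)
    refine ⟨X, hXU, hXne', ?_⟩
    by_cases h2 : u ∈ X <;> by_cases h3 : v ∈ X <;> simp [hGdef, h2, h3, hsX] at hlt hge ⊢ <;>
      omega
  have hdeg1 : cutSize G₁ {s} ≠ 0 := by
    intro h0
    simp [hGdef, h0, hvs] at heven
  obtain ⟨u₀, H₀, hu₀, hG₁⟩ := exists_eq_cons_of_cutSize_singleton_ne_zero hdeg1
  have hdeg : 2 ≤ cutSize G {s} := by
    rcases heven with ⟨m, hm⟩; omega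
  -- a maximal dangerous set containing `v`
  obtain ⟨X, hX, hXmax⟩ := Finset.exists_max_image
    (U.powerset.filter fun X => X ≠ U ∧ v ∈ X ∧ cutSize G X ≤ 2 * k + 1) Finset.card (by
      obtain ⟨X, h1, h2, h3, -, h4⟩ := key u₀ hu₀ (by simp [hG₁])
      exact ⟨X, by simp [h1, h2, h3, h4]⟩)
  simp only [Finset.mem_filter, Finset.mem_powerset] at hX hXmax
  obtain ⟨hXU, hXne, hvX, hXcut⟩ := hX
  obtain ⟨u, huG, hus, huX⟩ : ∃ u, s(s, u) ∈ G ∧ u ≠ s ∧ u ∉ X := by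
    by_contra hall
    push Not at hall
    have h1 := cutSize_eq_add_of_neighbors_mem hs hG hXU hall
    have h2 := hconn (U \ X) Finset.sdiff_subset
      (by rw [Finset.sdiff_nonempty]; exact fun h => hXne (hXU.antisymm h))
      (fun h => by rw [← h] at hvU; simp [hvX] at hvU)
    omega
  have huG₁ : s(s, u) ∈ G₁ := by
    rcases Multiset.mem_cons.1 huG with h | h
    · exact absurd ((Sym2.congr_right.1 h) ▸ hvX) huX
    · exact h
  obtain ⟨Y, hYU, hYne, hvY, huY, hYcut⟩ := key u hus huG₁
  have hXY : ¬ X ⊆ Y := by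
    intro h
    have := hXmax Y ⟨hYU, hYne, hvY, hYcut⟩
    exact huX (Finset.eq_of_subset_of_card_le h this ▸ huY)
  have hp := hconn (X \ Y) (Finset.sdiff_subset.trans hXU) (Finset.sdiff_nonempty.2 hXY)
    (fun h => (Finset.mem_sdiff.1 (h ▸ hvU : v ∈ X \ Y)).2 hvY)
  have hq := hconn (Y \ X) (Finset.sdiff_subset.trans hYU) ⟨u, by simp [huX, huY]⟩
    (fun h => (Finset.mem_sdiff.1 (h ▸ hvU : v ∈ Y \ X)).2 hvX)
  have hr := hconn (X ∩ Y) (Finset.inter_subset_left.trans hXU) ⟨v, by simp [hvX, hvY]⟩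
    (fun h => hXne (hXU.antisymm (h ▸ Finset.inter_subset_left)))
  have hsX : s ∉ X := fun h => hs (hXU h)
  have hsY : s ∉ Y := fun h => hs (hYU h)
  have hposi : cutSize G (X \ Y) + cutSize G (Y \ X) + 2 ≤ cutSize G X + cutSize G Y := by
    have := cutSize_posimodular G₁ X Y
    simp [hGdef, hsX, hsY, hvX, hvY]
    omega
  by_cases hU : X ∪ Y = U
  · have h1 := even_cutSize_of_disjoint G (X := X) (Y := Y \ X) Finset.disjoint_sdiff
    have h2 := even_cutSize_of_disjoint G (X := U) (Y := {s}) (by simpa using hs)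
    have h3 : cutSize G (U ∪ {s}) = 0 := cutSize_eq_zero_of_within hG
      (Or.inr (by rw [Finset.union_comm]; exact subset_rfl))
    rw [Finset.union_sdiff_self_eq_union, hU] at h1
    rw [Nat.even_iff] at *
    omega
  · have h1 : 2 * k + 2 ≤ cutSize G (X ∪ Y) := by
      by_contra hlt
      have := hXmax (X ∪ Y) ⟨Finset.union_subset hXU hYU, hU, by simp [hvX], by omega⟩
      exact huX (Finset.eq_of_subset_of_card_le Finset.subset_union_left this ▸
        Finset.mem_union_right _ huY)
    have h2 := cutSize_submodular G X Y
    have h3 := even_cutSize_of_disjoint G (X := X \ Y) (Y := X ∩ Y)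
      (Finset.disjoint_sdiff_inter X Y)
    rw [Finset.sdiff_union_inter] at h3
    rw [Nat.even_iff] at *
    omega

/-- Complete splitting off: a vertex `s` of even degree outside `U` can be removed by pairing up
its edges. -/
lemma exists_complete_split {k : ℕ} {U : Finset V} {s : V} (hs : s ∉ U)
    {G : Multiset (Sym2 V)} (hG : Within (insert s U) G) (hconn : EdgeConnOn (2 * k) U G)
    (heven : Even (cutSize G {s})) :
    ∃ G', Within U G' ∧ EdgeConnOn (2 * k) U G' ∧ (∀ X, cutSize G' X ≤ cutSize G X) ∧
      ∀ X, Even (cutSize G' X + cutSize G X) := by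
  induction hd : cutSize G {s} using Nat.strong_induction_on generalizing G with
  | _ d ih =>
  by_cases h0 : cutSize G {s} = 0
  · refine ⟨G.filter fun e => s ∉ e, ?_, ?_⟩
    · intro e he a ha
      rw [Multiset.mem_filter] at he
      exact Finset.mem_of_mem_insert_of_ne (hG e he.1 a ha) (fun h => he.2 (h ▸ ha))
    -- the discarded edges are loops at `s`
    · have : ∀ X, cutSize (G.filter fun e => s ∉ e) X = cutSize G X := by
        clear ih hconn hG heven hd
        intro X
        induction G using Multiset.induction with
        | empty => simp
        | cons e G ih =>
          rw [cutSize_cons] at h0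
          by_cases he : s ∈ e
          · rw [Multiset.filter_cons_of_neg _ (by simpa using he), cutSize_cons, ih (by omega)]
            obtain ⟨b, rfl⟩ := Sym2.mem_iff_exists.1 he
            by_cases hb : b = s
            · subst hb; simp
            · simp [hb] at h0
          · rw [Multiset.filter_cons_of_pos _ (by simpa using he), cutSize_cons, cutSize_cons,
              ih (by omega)]
      simp only [EdgeConnOn, this]
      exact ⟨hconn, fun _ => le_rfl, fun X => ⟨_, rfl⟩⟩
  · obtain ⟨u, v, H, hu, hv, rfl, hc⟩ := exists_split hs hG hconn heven h0
    have hd' : cutSize (s(v, u) ::ₘ H) {s} + 2 = d := by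
      rw [← hd]; simp [hu, hv]; omega
    have hev := even_cutSize_split s u v H
    have hle := cutSize_split_le s u v H
    simp only [within_cons] at hG
    obtain ⟨G', h1, h2, h3, h4⟩ := ih _ (by omega)
      (by simp only [within_cons]; exact ⟨⟨hG.1.2, hG.2.1.2⟩, hG.2.2⟩) hc
      (by have := hev {s}; rw [Nat.even_iff] at *; omega) rfl
    refine ⟨G', h1, h2, fun X => (h3 X).trans (hle X), fun X => ?_⟩
    have h5 := hev X
    have h6 := h4 X
    rw [Nat.even_iff] at *
    omega

/-- In an edge-minimal `k`-edge-connected multigraph every edge lies in a tight cut. -/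
lemma exists_tight_of_minimal {k : ℕ} {U : Finset V} {G : Multiset (Sym2 V)}
    (hconn : EdgeConnOn k U G) (hmin : ∀ e H, G = e ::ₘ H → ¬ EdgeConnOn k U H)
    {e : Sym2 V} (he : e ∈ G) :
    ∃ X ⊆ U, X.Nonempty ∧ X ≠ U ∧ cutSize G X = k ∧ crossing X e = 1 := by
  obtain ⟨H, rfl⟩ := Multiset.exists_cons_of_mem he
  have := hmin e H rfl
  simp only [EdgeConnOn, not_forall] at this
  obtain ⟨X, h1, h2, h3, h4⟩ := this
  refine ⟨X, h1, h2, h3, ?_⟩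
  have h5 := hconn X h1 h2 h3
  rw [cutSize_cons] at h5 ⊢
  have h6 : crossing X e ≤ 1 := by
    induction e using Sym2.ind; simp only [crossing_mk]; split_ifs <;> omega
  omega

/-- An edge-minimal `k`-edge-connected multigraph has a vertex of degree `k`: a minimal tight set
is a singleton, since otherwise it contains an edge, and uncrossing it with a tight cut through
that edge produces a smaller tight set. -/
lemma exists_cutSize_singleton_eq {k : ℕ} (hk : 0 < k) {U : Finset V} (hU : 2 ≤ U.card)
    {G : Multiset (Sym2 V)}
    (hG : Within U G) (hconn : EdgeConnOn k U G)
    (hmin : ∀ e H, G = e ::ₘ H → ¬ EdgeConnOn k U H) :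
    ∃ s ∈ U, cutSize G {s} = k := by
  have tight := fun e (he : e ∈ G) => exists_tight_of_minimal hconn hmin he
  obtain ⟨a, ha⟩ : U.Nonempty := Finset.card_pos.1 (by omega)
  have hsing : ∀ a ∈ U, ({a} : Finset V) ≠ U := fun a _ h => by rw [← h] at hU; simp at hU
  have hane : cutSize G {a} ≠ 0 := by
    have := hconn {a} (by simpa using ha) ⟨a, by simp⟩ (hsing a ha)
    omega
  obtain ⟨X, hX, hXmin⟩ := Finset.exists_min_image
    (U.powerset.filter fun X => X.Nonempty ∧ X ≠ U ∧ cutSize G X = k) Finset.card (by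
      obtain ⟨v, H, hv, rfl⟩ := exists_eq_cons_of_cutSize_singleton_ne_zero hane
      obtain ⟨X, h1, h2, h3, h4, -⟩ := tight _ (Multiset.mem_cons_self _ _)
      exact ⟨X, by simp only [Finset.mem_filter, Finset.mem_powerset]; exact ⟨h1, h2, h3, h4⟩⟩)
  simp only [Finset.mem_filter, Finset.mem_powerset] at hX hXmin
  obtain ⟨hXU, hXne, hXU', hXk⟩ := hX
  by_contra hno
  push Not at hno
  -- there is an edge inside `X`, because the degrees in `X` exceed `cutSize G X`
  obtain ⟨b, hb⟩ := hXne
  have hbk : k < cutSize G {b} := lt_of_le_of_ne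
    (hconn {b} (by simpa using hXU hb) ⟨b, by simp⟩ (hsing b (hXU hb))) (hno b (hXU hb)).symm
  obtain ⟨c, hcb, hcX, hcG⟩ : ∃ c, c ≠ b ∧ c ∈ X ∧ s(b, c) ∈ G := by
    by_contra hnone
    push Not at hnone
    have : cutSize G {b} ≤ cutSize G X := by
      clear tight hmin hno hbk hconn hXmin hXk hane hG
      induction G using Multiset.induction with
      | empty => simp
      | cons e G ih =>
        have := ih fun c h1 h2 h3 => hnone c h1 h2 (Multiset.mem_cons_of_mem h3)
        simp only [cutSize_cons]
        have : crossing {b} e ≤ crossing X e := by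
          by_cases hbe : b ∈ e
          · obtain ⟨c, rfl⟩ := Sym2.mem_iff_exists.1 hbe
            by_cases hcb : c = b
            · subst hcb; simp
            · have : c ∉ X := fun h => hnone c hcb h (Multiset.mem_cons_self _ _)
              simp [hcb, hb, this]
          · induction e using Sym2.ind with
            | _ x y =>
              simp only [Sym2.mem_iff, not_or] at hbe
              simp [Ne.symm hbe.1, Ne.symm hbe.2]
        omega
    omega
  obtain ⟨Y, hYU, -, -, hYk, hYe⟩ := tight _ hcG
  -- one of `Y` and its complement may be chosen to contain `b`; uncrossing with `X` then yields
  -- a smaller tight set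
  have main : ∀ Y ⊆ U, cutSize G Y = k → (∃ x ∈ X, x ∈ Y) → (∃ x ∈ X, x ∉ Y) → False := by
    rintro Y hYU hYk ⟨x, hxX, hxY⟩ ⟨y, hyX, hyY⟩
    by_cases hun : X ∪ Y = U
    · obtain ⟨z, hzU, hzX⟩ : ∃ z ∈ U, z ∉ X := by
        by_contra hall; push Not at hall
        exact hXU' (hXU.antisymm hall)
      have hzY : z ∈ Y := by
        rw [← hun, Finset.mem_union] at hzU
        exact hzU.resolve_left hzX
      have hd1 : X \ Y ≠ U := fun h => by
        have := h ▸ hzU; simp [hzX] at this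
      have h1 := hconn (X \ Y) (Finset.sdiff_subset.trans hXU) ⟨y, by simp [hyX, hyY]⟩ hd1
      have h2 := hconn (Y \ X) (Finset.sdiff_subset.trans hYU) ⟨z, by simp [hzX, hzY]⟩
        (fun h => by have := h ▸ (hXU hxX); simp [hxX] at this)
      have h3 := cutSize_posimodular G X Y
      have h4 := hXmin (X \ Y) ⟨Finset.sdiff_subset.trans hXU, ⟨y, by simp [hyX, hyY]⟩, hd1,
        by omega⟩
      have := Finset.eq_of_subset_of_card_le Finset.sdiff_subset h4 ▸ hxX
      simp [hxY] at this
    · have hd1 : X ∩ Y ≠ U := fun h => hXU' (hXU.antisymm (h ▸ Finset.inter_subset_left))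
      have h1 := hconn (X ∩ Y) (Finset.inter_subset_left.trans hXU) ⟨x, by simp [hxX, hxY]⟩ hd1
      have h2 := hconn (X ∪ Y) (Finset.union_subset hXU hYU) ⟨x, by simp [hxX]⟩ hun
      have h3 := cutSize_submodular G X Y
      have h4 := hXmin (X ∩ Y) ⟨Finset.inter_subset_left.trans hXU, ⟨x, by simp [hxX, hxY]⟩, hd1,
        by omega⟩
      have := Finset.eq_of_subset_of_card_le Finset.inter_subset_left h4 ▸ hyX
      simp [hyY] at this
  rw [crossing_mk] at hYe
  by_cases hbY : b ∈ Y
  · by_cases hcY : c ∈ Y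
    · simp [hbY, hcY] at hYe
    · exact main Y hYU hYk ⟨b, hb, hbY⟩ ⟨c, hcX, hcY⟩
  · by_cases hcY : c ∈ Y
    · exact main Y hYU hYk ⟨c, hcX, hcY⟩ ⟨b, hb, hbY⟩
    · simp [hbY, hcY] at hYe

/-- A weak form of Nash-Williams' odd-vertex pairing theorem: a `2k`-edge-connected multigraph `G`
has a companion `M` whose degrees have the same parities and whose cuts are smaller by `2k` than
those of `G`. -/
theorem exists_odd_pairing (k : ℕ) (hk : 0 < k) (U : Finset V) (G : Multiset (Sym2 V))
    (hG : Within U G) (hconn : EdgeConnOn (2 * k) U G) :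
    ∃ M, Within U M ∧ (∀ X, Even (cutSize M X + cutSize G X)) ∧
      ∀ X ⊆ U, X.Nonempty → X ≠ U → cutSize M X + 2 * k ≤ cutSize G X := by
  induction hm : U.card using Nat.strong_induction_on generalizing U G with
  | _ m ihU =>
  induction hc : G.card using Nat.strong_induction_on generalizing G with
  | _ c ihG =>
  by_cases hsmall : U.card < 2
  · have hU : ∀ X ⊆ U, X.Nonempty → X = U := fun X hX hne =>
      Finset.eq_of_subset_of_card_le hX (by have := hne.card_pos; omega)
    refine ⟨0, by simp [Within], fun X => ?_, fun X h1 h2 h3 => absurd (hU X h1 h2) h3⟩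
    have : cutSize G X = 0 := by
      by_cases hne : (X ∩ U).Nonempty
      · exact cutSize_eq_zero_of_within hG (Or.inr
          (by rw [← hU _ Finset.inter_subset_right hne]; exact Finset.inter_subset_left))
      · exact cutSize_eq_zero_of_within hG (Or.inl (Finset.not_nonempty_iff_eq_empty.1 hne))
    simp [this]
  by_cases hrem : ∃ e H, G = e ::ₘ H ∧ EdgeConnOn (2 * k) U H
  · obtain ⟨e, H, rfl, hH⟩ := hrem
    have hHU : Within U H := fun e' he' => hG e' (Multiset.mem_cons_of_mem he')
    obtain ⟨M, h1, h2, h3⟩ := ihG H.card (by rw [← hc]; simp) H hHU hH rfl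
    refine ⟨e ::ₘ M, ?_, fun X => ?_, fun X hX hX1 hX2 => ?_⟩
    · intro e' he'
      rcases Multiset.mem_cons.1 he' with rfl | h
      · exact hG _ (Multiset.mem_cons_self _ _)
      · exact h1 e' h
    · have := h2 X
      simp only [cutSize_cons]
      rw [Nat.even_iff] at *; omega
    · have := h3 X hX hX1 hX2
      simp only [cutSize_cons]
      omega
  push Not at hrem
  obtain ⟨s, hsU, hsk⟩ := exists_cutSize_singleton_eq (by omega) (by omega) hG hconn hrem
  have hins : insert s (U.erase s) = U := Finset.insert_erase hsU
  have hs : s ∉ U.erase s := Finset.notMem_erase s U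
  obtain ⟨G', hG'1, hG'2, hG'3, hG'4⟩ := exists_complete_split (k := k) hs (by rwa [hins])
    (fun X hX h1 h2 => hconn X (hX.trans (Finset.erase_subset _ _)) h1
      (fun h => hs (hX (h ▸ hsU)))) (by rw [hsk]; simp)
  obtain ⟨M, hM1, hM2, hM3⟩ := ihU (U.erase s).card
    (by rw [← hm]; exact Finset.card_erase_lt_of_mem hsU) (U.erase s) G' hG'1 hG'2 rfl
  have hM1' : Within U M := hM1.mono (Finset.erase_subset _ _)
  refine ⟨M, hM1', fun X => ?_, ?_⟩
  · have h1 := hM2 X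
    have h2 := hG'4 X
    rw [Nat.even_iff] at *; omega
  · have main : ∀ X ⊆ U, X.Nonempty → X ≠ U → s ∉ X →
        cutSize M X + 2 * k ≤ cutSize G X := by
      intro X hX h1 h2 hsX
      by_cases hXe : X = U.erase s
      · rw [cutSize_eq_zero_of_within hM1 (Or.inr hXe.symm.subset), zero_add]
        exact hconn X hX h1 h2
      · exact (hM3 X (Finset.subset_erase.2 ⟨hX, hsX⟩) h1 hXe).trans (hG'3 X)
    intro X hX h1 h2
    by_cases hsX : s ∈ X
    · rw [← cutSize_sdiff_of_within hG X, ← cutSize_sdiff_of_within hM1' X]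
      refine main (U \ X) Finset.sdiff_subset ?_ ?_ (by simp [hsX])
      · rw [Finset.sdiff_nonempty]; exact fun h => h2 (hX.antisymm h)
      · exact fun h => by have := h ▸ hsU; simp [hsX] at this
    · exact main X hX h1 h2 hsX

end Splitting

/-! ### Orientations preserving digons -/

section Orientation

variable {V : Type*} [DecidableEq V]

/-- The number of arcs of `O` that leave `X`. -/
def outSize (O : Multiset (V × V)) (X : Finset V) : ℕ := O.countP fun p => p.1 ∈ X ∧ p.2 ∉ X

/-- The number of arcs of `O` that enter `X`. -/
def inSize (O : Multiset (V × V)) (X : Finset V) : ℕ := O.countP fun p => p.1 ∉ X ∧ p.2 ∈ X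

@[simp]
lemma outSize_cons (a b : V) (O : Multiset (V × V)) (X : Finset V) :
    outSize ((a, b) ::ₘ O) X = outSize O X + if a ∈ X ∧ b ∉ X then 1 else 0 := by
  simp [outSize, Multiset.countP_cons]

@[simp]
lemma inSize_cons (a b : V) (O : Multiset (V × V)) (X : Finset V) :
    inSize ((a, b) ::ₘ O) X = inSize O X + if a ∉ X ∧ b ∈ X then 1 else 0 := by
  simp [inSize, Multiset.countP_cons]

lemma outSize_add_inSize (O : Multiset (V × V)) (X : Finset V) :
    outSize O X + inSize O X = cutSize (O.map fun p => s(p.1, p.2)) X := by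
  induction O using Multiset.induction with
  | empty => simp [outSize, inSize]
  | cons p O ih =>
    obtain ⟨a, b⟩ := p
    simp only [outSize_cons, inSize_cons, Multiset.map_cons, cutSize_cons, ← ih]
    by_cases h1 : a ∈ X <;> by_cases h2 : b ∈ X <;> simp [h1, h2] <;> omega

/-- A multigraph with all degrees even has an orientation in which every cut is balanced. -/
theorem exists_balanced_orientation (H : Multiset (Sym2 V))
    (hH : ∀ v, Even (cutSize H {v})) :
    ∃ O : Multiset (V × V), O.map (fun p => s(p.1, p.2)) = H ∧
      ∀ X, outSize O X = inSize O X := by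
  induction hc : H.card using Nat.strong_induction_on generalizing H with
  | _ c ih =>
  induction H using Multiset.induction with
  | empty => exact ⟨0, by simp, fun X => by simp [outSize, inSize]⟩
  | cons e H _ =>
    induction e using Sym2.ind with
    | _ a b =>
    by_cases hab : b = a
    · subst hab
      obtain ⟨O, h1, h2⟩ := ih H.card (by rw [← hc]; simp) H (fun v => by simpa using hH v) rfl
      exact ⟨(b, b) ::ₘ O, by simp [h1], fun X => by simp [h2]⟩
    -- replace the path `b a d` by the edge `b d`
    · obtain ⟨d, H, hd, rfl⟩ := exists_eq_cons_of_cutSize_singleton_ne_zero (s := a) (G := H) (by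
        intro h0
        have := hH a
        simp [h0, hab] at this)
      obtain ⟨O, h1, h2⟩ := ih (s(b, d) ::ₘ H).card (by rw [← hc]; simp) (s(b, d) ::ₘ H) (by
        intro v
        have h1 := hH v
        have h2 := even_cutSize_split a d b H {v}
        rw [Nat.even_iff] at *
        omega) rfl
      have hmem : s(b, d) ∈ O.map (fun p => s(p.1, p.2)) := by
        rw [h1]; exact Multiset.mem_cons_self _ _
      obtain ⟨⟨x, y⟩, hxy, hxy'⟩ := Multiset.mem_map.1 hmem
      obtain ⟨O, rfl⟩ := Multiset.exists_cons_of_mem hxy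
      have hbal : ∀ X, outSize ((x, a) ::ₘ (a, y) ::ₘ O) X =
          inSize ((x, a) ::ₘ (a, y) ::ₘ O) X := by
        intro X
        have := h2 X
        by_cases hx : x ∈ X <;> by_cases hy : y ∈ X <;> by_cases ha : a ∈ X <;>
          simp [hx, hy, ha] at this ⊢ <;> omega
      refine ⟨(x, a) ::ₘ (a, y) ::ₘ O, ?_, hbal⟩
      simp only [Multiset.map_cons] at h1 ⊢
      simp only at hxy'
      rw [hxy', Multiset.cons_inj_right] at h1
      rw [h1]
      rcases Sym2.eq_iff.1 hxy' with ⟨rfl, rfl⟩ | ⟨rfl, rfl⟩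
      · rw [Sym2.eq_swap]
      · rw [Multiset.cons_swap, Sym2.eq_swap (a := x)]

lemma exists_add_of_map_eq_add {α β : Type*} (f : α → β) (s : Multiset α) (t u : Multiset β)
    (h : s.map f = t + u) : ∃ s₁ s₂, s = s₁ + s₂ ∧ s₁.map f = t ∧ s₂.map f = u := by
  induction t using Multiset.induction generalizing s with
  | empty => exact ⟨0, s, by simp, by simp, by simpa using h⟩
  | cons b t ih =>
    have hb : b ∈ s.map f := by rw [h]; simp
    obtain ⟨a, ha, rfl⟩ := Multiset.mem_map.1 hb
    obtain ⟨s, rfl⟩ := Multiset.exists_cons_of_mem ha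
    rw [Multiset.map_cons, Multiset.cons_add, Multiset.cons_inj_right] at h
    obtain ⟨s₁, s₂, rfl, h1, h2⟩ := ih s h
    exact ⟨a ::ₘ s₁, s₂, by simp, by simp [h1], h2⟩

/-- Nash-Williams' orientation theorem in the presence of digons: if doubling the edges of `Q`
makes `P + Q` a `2k`-edge-connected multigraph, then `P` has an orientation that is `k`-arc-strong
once every edge of `Q` is replaced by a digon.

The orientation is the restriction to `P` of a balanced orientation of `P + M`, where `M` is the
companion of `P + Q + Q` from `exists_odd_pairing`. -/
theorem exists_arcStrong_orientation [Fintype V] {k : ℕ} (hk : 0 < k) (P Q : Multiset (Sym2 V))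
    (h : EdgeConnOn (2 * k) Finset.univ (P + Q + Q)) :
    ∃ O : Multiset (V × V), O.map (fun p => s(p.1, p.2)) = P ∧
      ∀ X : Finset V, X.Nonempty → X ≠ Finset.univ → k ≤ outSize O X + cutSize Q X := by
  obtain ⟨M, -, h2, h3⟩ := exists_odd_pairing k hk _ _ (fun _ _ _ _ => Finset.mem_univ _) h
  obtain ⟨O, hO, hbal⟩ := exists_balanced_orientation (P + M) (fun v => by
    have := h2 {v}
    simp only [cutSize_add] at this ⊢
    rw [Nat.even_iff] at *
    omega)
  obtain ⟨O₁, O₂, rfl, h4, h5⟩ := exists_add_of_map_eq_add _ _ _ _ hO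
  refine ⟨O₁, h4, fun X hX hX' => ?_⟩
  have e1 := h3 X (Finset.subset_univ _) hX hX'
  have e2 := hbal X
  have e3 := outSize_add_inSize O₁ X
  have e4 := outSize_add_inSize O₂ X
  rw [h4] at e3
  rw [h5] at e4
  simp only [outSize, inSize, Multiset.countP_add, cutSize_add] at *
  omega

end Orientation

/-! ### Tight sets of an edge-minimal multigraph -/

section TightSets

variable {V : Type*} [DecidableEq V] [Fintype V]

lemma card_cut_le_cutSize (G : Multiset (Sym2 V)) (X : Finset V) :
    (Finset.univ.filter fun p : V × V => p.1 ∈ X ∧ p.2 ∉ X ∧ s(p.1, p.2) ∈ G).card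
      ≤ cutSize G X := by
  induction G using Multiset.induction with
  | empty => simp
  | cons e G ih =>
    have h1 : (Finset.univ.filter fun p : V × V => p.1 ∈ X ∧ p.2 ∉ X ∧ s(p.1, p.2) ∈ e ::ₘ G) ⊆
        (Finset.univ.filter fun p : V × V => p.1 ∈ X ∧ p.2 ∉ X ∧ s(p.1, p.2) = e) ∪
        Finset.univ.filter fun p : V × V => p.1 ∈ X ∧ p.2 ∉ X ∧ s(p.1, p.2) ∈ G := by
      intro p hp
      simp only [Finset.mem_filter, Multiset.mem_cons, Finset.mem_union] at hp ⊢
      tauto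
    have h2 : (Finset.univ.filter fun p : V × V => p.1 ∈ X ∧ p.2 ∉ X ∧ s(p.1, p.2) = e).card
        ≤ crossing X e := by
      rcases Finset.eq_empty_or_nonempty
        (Finset.univ.filter fun p : V × V => p.1 ∈ X ∧ p.2 ∉ X ∧ s(p.1, p.2) = e) with h | ⟨p, hp⟩
      · simp [h]
      · simp only [Finset.mem_filter, Finset.mem_univ, true_and] at hp
        obtain ⟨hp1, hp2, rfl⟩ := hp
        simp only [crossing_mk, hp1, hp2, iff_false, not_true_eq_false, if_false]
        rw [Finset.card_le_one]
        rintro ⟨a, b⟩ ha ⟨c, d⟩ hc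
        simp only [Finset.mem_filter, Finset.mem_univ, true_and, Sym2.eq_iff] at ha hc
        rcases ha with ⟨ha1, ha2, ⟨rfl, rfl⟩ | ⟨rfl, rfl⟩⟩
        · rcases hc with ⟨hc1, hc2, ⟨rfl, rfl⟩ | ⟨rfl, rfl⟩⟩
          · rfl
          · exact absurd hc1 hp2
        · exact absurd ha1 hp2
    calc _ ≤ _ := Finset.card_le_card h1
      _ ≤ _ := Finset.card_union_le _ _
      _ ≤ _ := by rw [cutSize_cons]; omega

/-- A hierarchy of small cuts. Fix a root `r`; then `S v` is the smallest tight set that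
contains `v` and avoids `r`, or the whole vertex set if there is none. Adjacent vertices are
separated by a tight set, hence never lie in each other's sets. -/
theorem exists_tight_hierarchy {k : ℕ} {G : Multiset (Sym2 V)}
    (hconn : EdgeConnOn k Finset.univ G)
    (hmin : ∀ e H, G = e ::ₘ H → ¬ EdgeConnOn k Finset.univ H) :
    ∃ S : V → Finset V, (∀ v, v ∈ S v) ∧ (∀ u v, u ∈ S v → S u ⊆ S v) ∧
      (∀ u v, s(u, v) ∈ G → u ∉ S v ∨ v ∉ S u) ∧ ∀ v, cutSize G (S v) ≤ k := by
  rcases isEmpty_or_nonempty V with hV | ⟨⟨r⟩⟩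
  · exact ⟨fun _ => ∅, isEmptyElim, isEmptyElim, isEmptyElim, isEmptyElim⟩
  have hG : Within Finset.univ G := fun _ _ _ _ => Finset.mem_univ _
  set F : Finset (Finset V) :=
    Finset.univ.filter fun X => X = Finset.univ ∨ (r ∉ X ∧ cutSize G X = k) with hF
  have memF : ∀ X, X ∈ F ↔ X = Finset.univ ∨ (r ∉ X ∧ cutSize G X = k) := by simp [hF]
  have hinter : ∀ X ∈ F, ∀ Y ∈ F, (X ∩ Y).Nonempty → X ∩ Y ∈ F := by
    intro X hX Y hY hne
    rcases (memF X).1 hX with rfl | ⟨hrX, hXk⟩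
    · simpa using hY
    rcases (memF Y).1 hY with rfl | ⟨hrY, hYk⟩
    · simpa using hX
    rw [memF]
    right
    have hr1 : r ∉ X ∩ Y := by simp [hrX]
    have hr2 : r ∉ X ∪ Y := by simp [hrX, hrY]
    refine ⟨hr1, ?_⟩
    have h1 := hconn (X ∩ Y) (Finset.subset_univ _) hne (fun h => hr1 (h ▸ Finset.mem_univ r))
    have h2 := hconn (X ∪ Y) (Finset.subset_univ _)
      (hne.mono (Finset.inter_subset_left.trans Finset.subset_union_left))
      (fun h => hr2 (h ▸ Finset.mem_univ r))
    have h3 := cutSize_submodular G X Y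
    omega
  have hex : ∀ v, ∃ X ∈ F, v ∈ X ∧ ∀ Y ∈ F, v ∈ Y → X ⊆ Y := by
    intro v
    obtain ⟨X, hX, hXmin⟩ := Finset.exists_min_image (F.filter fun X => v ∈ X) Finset.card
      ⟨Finset.univ, by simp [memF]⟩
    rw [Finset.mem_filter] at hX
    refine ⟨X, hX.1, hX.2, fun Y hY hvY => ?_⟩
    have hv : v ∈ X ∩ Y := Finset.mem_inter.2 ⟨hX.2, hvY⟩
    have := hXmin (X ∩ Y) (Finset.mem_filter.2 ⟨hinter X hX.1 Y hY ⟨v, hv⟩, hv⟩)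
    rw [← Finset.eq_of_subset_of_card_le Finset.inter_subset_left this]
    exact Finset.inter_subset_right
  choose S hSF hvS hSmin using hex
  refine ⟨S, hvS, fun u v huv => hSmin u _ (hSF v) huv, fun u v huv => ?_, fun v => ?_⟩
  · have key : ∀ X, r ∉ X → cutSize G X = k → crossing X s(u, v) = 1 → u ∉ S v ∨ v ∉ S u := by
      intro X hrX hXk hX
      have hXF : X ∈ F := (memF X).2 (Or.inr ⟨hrX, hXk⟩)
      by_cases hu : u ∈ X <;> by_cases hv : v ∈ X
      · simp [hu, hv] at hX
      · exact Or.inr fun h => hv (hSmin u X hXF hu h)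
      · exact Or.inl fun h => hu (hSmin v X hXF hv h)
      · simp [hu, hv] at hX
    obtain ⟨X, -, -, -, hXk, hX⟩ := exists_tight_of_minimal hconn hmin huv
    by_cases hrX : r ∈ X
    · refine key (Finset.univ \ X) (by simp [hrX]) ?_ ?_
      · rw [cutSize_sdiff_of_within hG, hXk]
      · by_cases hu : u ∈ X <;> by_cases hv : v ∈ X <;> simp [hu, hv] at hX ⊢
    · exact key X hrX hXk hX
  · rcases (memF _).1 (hSF v) with h | ⟨-, h⟩
    · rw [h, cutSize_eq_zero_of_within hG (Or.inr subset_rfl)]; omega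
    · exact h.le

end TightSets

/-! ### Vectors over the field with two elements with prescribed dot products -/

section Vectors

open Finset

lemma linearIndependent_zmod_two_of_sum_ne_zero {ι M : Type*} [AddCommGroup M] [Module (ZMod 2) M]
    {N : Finset ι} {x : ι → M} (h : ∀ T ⊆ N, T.Nonempty → ∑ u ∈ T, x u ≠ 0) :
    LinearIndependent (ZMod 2) (fun u : N => x u) := by
  classical
  rw [Fintype.linearIndependent_iff]
  intro g hg
  by_contra hne
  push Not at hne
  obtain ⟨i, hi⟩ := hne
  have h01 : ∀ a : ZMod 2, a ≠ 0 → a = 1 := by decide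
  refine h ((univ.filter fun u : N => g u ≠ 0).map (Function.Embedding.subtype _)) ?_ ?_ ?_
  · intro u hu
    rw [mem_map] at hu
    obtain ⟨v, -, rfl⟩ := hu
    exact v.2
  · exact ⟨i, mem_map_of_mem _ (by simpa using hi)⟩
  · rw [sum_map, ← hg, sum_filter]
    refine sum_congr rfl fun u _ => ?_
    by_cases hu : g u = 0
    · simp [hu]
    · simp [h01 _ hu]

/-- A system of independent linear equations over `ZMod 2` in `t` unknowns has the expected number
of solutions. -/
lemma card_solutions {V : Type*} [DecidableEq V] {t : ℕ} {N : Finset V} {x : V → Fin t → ZMod 2}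
    (h : ∀ T ⊆ N, T.Nonempty → ∑ u ∈ T, x u ≠ 0) (b : V → ZMod 2) :
    (univ.filter fun y : Fin t → ZMod 2 => ∀ u ∈ N, x u ⬝ᵥ y = b u).card * 2 ^ N.card = 2 ^ t := by
  classical
  set A : Matrix N (Fin t) (ZMod 2) := fun u => x u with hA
  have hli : LinearIndependent (ZMod 2) A := linearIndependent_zmod_two_of_sum_ne_zero h
  have hsurj : Function.Surjective A.mulVecLin := by
    rw [← LinearMap.range_eq_top]
    apply Submodule.eq_top_of_finrank_eq
    have : Module.finrank (ZMod 2) (LinearMap.range A.mulVecLin) = Fintype.card N :=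
      LinearIndependent.rank_matrix (M := A) hli
    rw [this]; simp
  have hfib : ∀ z : N → ZMod 2, (univ.filter fun y => A.mulVecLin y = z).card =
      (univ.filter fun y => A.mulVecLin y = fun u : N => b u).card := fun z =>
    AddMonoidHom.card_fiber_eq_of_mem_range A.mulVecLin (hsurj z) (hsurj _)
  have htot := card_eq_sum_card_fiberwise (s := (univ : Finset (Fin t → ZMod 2)))
    (t := (univ : Finset (N → ZMod 2))) (f := A.mulVecLin) (fun _ _ => by simp)
  simp only [hfib, sum_const, card_univ, Fintype.card_fun, ZMod.card, Fintype.card_fin,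
    Fintype.card_coe, smul_eq_mul] at htot
  rw [htot, mul_comm]
  congr 2
  ext y
  simp only [mem_filter, mem_univ, true_and, funext_iff, Subtype.forall]
  rfl

variable {V : Type*} [DecidableEq V] [Fintype V] (Γ : SimpleGraph V) [DecidableRel Γ.Adj]
  (f : V → ℤ)

/-- The neighbours of `v` that precede `v` in the order given by `f`. -/
def earlierNeighbors (v : V) : Finset V := univ.filter fun u => Γ.Adj u v ∧ f u < f v

/-- The neighbours of `v` that follow `v` in the order given by `f`. -/
def laterNeighbors (v : V) : Finset V := univ.filter fun w => Γ.Adj v w ∧ f v < f w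

/-- The neighbours of `w` that precede `v` in the order given by `f`. -/
def neighborsBefore (v w : V) : Finset V := univ.filter fun u => Γ.Adj u w ∧ f u < f v

/-- The sets of vertices whose sum the vector of `v` must avoid: for each later neighbour `w` of
`v`, the subsets of the neighbours of `w` that precede `v`. -/
def conflicts (v : V) : Finset (Finset V) :=
  (laterNeighbors Γ f v).biUnion fun w => (neighborsBefore Γ f v w).powerset

/-- A greedy construction of vectors with prescribed dot products along the edges of a graph.
The vectors are chosen in the order given by `f`. The vector of `v` has to satisfy one linear
equation for each earlier neighbour, and it has to avoid the sums over `conflicts Γ f v`, so that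
the earlier neighbours of each vertex stay linearly independent. -/
theorem exists_vectors_of_card_conflicts_lt (hf : Function.Injective f) (t : ℕ)
    (c : V → V → ZMod 2) (hc : ∀ u v, c u v = c v u)
    (hcount : ∀ v, (conflicts Γ f v).card * 2 ^ (earlierNeighbors Γ f v).card < 2 ^ t) :
    ∃ x : V → Fin t → ZMod 2, ∀ u v, Γ.Adj u v → x u ⬝ᵥ x v = c u v := by
  suffices H : ∀ s : Finset V, ∃ x : V → Fin t → ZMod 2,
      (∀ u ∈ s, ∀ v ∈ s, Γ.Adj u v → x u ⬝ᵥ x v = c u v) ∧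
      ∀ w, ∀ T ⊆ earlierNeighbors Γ f w, T ⊆ s → T.Nonempty → ∑ u ∈ T, x u ≠ 0 by
    obtain ⟨x, hx, -⟩ := H univ
    exact ⟨x, fun u v => hx u (mem_univ _) v (mem_univ _)⟩
  intro s
  induction s using Finset.induction_on_max_value f with
  | empty => exact ⟨0, by simp, fun w T _ h2 h3 => by simp [subset_empty.1 h2] at h3⟩
  | insert a s ha hmax ih =>
    obtain ⟨x, hx1, hx2⟩ := ih
    have hlt : ∀ u ∈ s, f u < f a := fun u hu =>
      lt_of_le_of_ne (hmax u hu) fun h => ha (hf h ▸ hu)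
    have hsol := card_solutions (N := earlierNeighbors Γ f a ∩ s) (x := x)
      (fun T hT hne => hx2 a T (hT.trans inter_subset_left) (hT.trans inter_subset_right) hne)
      (fun u => c u a)
    obtain ⟨y, hy1, hy2⟩ : ∃ y, (∀ u ∈ earlierNeighbors Γ f a ∩ s, x u ⬝ᵥ y = c u a) ∧
        y ∉ (conflicts Γ f a).image fun T => ∑ u ∈ T, x u := by
      by_contra hno
      push Not at hno
      have h1 : (univ.filter fun y : Fin t → ZMod 2 =>
          ∀ u ∈ earlierNeighbors Γ f a ∩ s, x u ⬝ᵥ y = c u a).card ≤ (conflicts Γ f a).card :=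
        (card_le_card fun y hy => hno y (mem_filter.1 hy).2).trans card_image_le
      have h2 : 2 ^ (earlierNeighbors Γ f a ∩ s).card ≤ 2 ^ (earlierNeighbors Γ f a).card :=
        Nat.pow_le_pow_right (by norm_num) (card_le_card inter_subset_left)
      exact ((Nat.mul_le_mul h1 h2).trans_lt (hcount a)).ne (by convert hsol)
    have hupd : ∀ T ⊆ s, ∑ u ∈ T, Function.update x a y u = ∑ u ∈ T, x u := fun T hT =>
      sum_congr rfl fun u hu => Function.update_of_ne (ne_of_mem_of_not_mem (hT hu) ha) _ _
    refine ⟨Function.update x a y, ?_, ?_⟩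
    · have hy : ∀ u ∈ s, Γ.Adj u a → x u ⬝ᵥ y = c u a := fun u hu hadj =>
        hy1 u (by simp [earlierNeighbors, hadj, hlt u hu, hu])
      intro u hu v hv hadj
      rcases mem_insert.1 hu with rfl | hu'
      · rcases mem_insert.1 hv with rfl | hv'
        · exact absurd hadj (Γ.irrefl)
        · rw [Function.update_self, Function.update_of_ne (ne_of_mem_of_not_mem hv' ha),
            dotProduct_comm, hy v hv' hadj.symm, hc]
      · rcases mem_insert.1 hv with rfl | hv'
        · rw [Function.update_self, Function.update_of_ne (ne_of_mem_of_not_mem hu' ha),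
            hy u hu' hadj]
        · rw [Function.update_of_ne (ne_of_mem_of_not_mem hu' ha),
            Function.update_of_ne (ne_of_mem_of_not_mem hv' ha), hx1 u hu' v hv' hadj]
    · intro w T hTw hTs hne
      by_cases haT : a ∈ T
      · have hTe : T.erase a ⊆ s := by
          intro u hu
          exact mem_of_mem_insert_of_ne (hTs (mem_of_mem_erase hu)) (ne_of_mem_erase hu)
        rw [← add_sum_erase _ _ haT, Function.update_self, hupd _ hTe]
        intro h0
        refine hy2 (mem_image.2 ⟨T.erase a, ?_, ?_⟩)
        · have haw := hTw haT
          simp only [earlierNeighbors, mem_filter, mem_univ, true_and] at haw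
          refine mem_biUnion.2
            ⟨w, by simpa [laterNeighbors] using haw, mem_powerset.2 fun u hu => ?_⟩
          have huw := hTw (mem_of_mem_erase hu)
          simp only [earlierNeighbors, mem_filter, mem_univ, true_and] at huw
          simpa [neighborsBefore] using ⟨huw.1, hlt u (hTe hu)⟩
        · have hneg : ∀ z : ZMod 2, -z = z := by decide
          rw [eq_neg_of_add_eq_zero_left h0]
          ext i
          simp [hneg]
      · have hTs' : T ⊆ s := fun u hu =>
          mem_of_mem_insert_of_ne (hTs hu) (fun h => haT (h ▸ hu))
        rw [hupd T hTs']
        exact hx2 w T hTw hTs' hne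

end Vectors

/-! ### An ordering with few conflicts -/

section Ordering

open Finset

lemma exists_injective_order {V : Type*} [Fintype V] (K : V → ℕ) :
    ∃ f : V → ℤ, Function.Injective f ∧ ∀ u v, f u < f v → K v ≤ K u := by
  set n := Fintype.card V
  set e := Fintype.equivFin V
  refine ⟨fun v => -((K v * n + (e v : ℕ) : ℕ) : ℤ), fun u v huv => ?_, fun u v huv => ?_⟩
  · simp only [neg_inj, Nat.cast_inj] at huv
    have h := congrArg (· % n) huv
    simp only [Nat.mul_add_mod_self_right] at h
    rw [Nat.mod_eq_of_lt (e u).isLt, Nat.mod_eq_of_lt (e v).isLt] at h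
    exact e.injective (Fin.ext h)
  · simp only [neg_lt_neg_iff, Nat.cast_lt] at huv
    by_contra! hlt
    have h1 : (K u + 1) * n ≤ K v * n := Nat.mul_le_mul_right _ hlt
    have h2 := (e u).isLt
    rw [add_mul, one_mul] at h1
    omega

variable {V : Type*} [DecidableEq V] [Fintype V] {Γ : SimpleGraph V} [DecidableRel Γ.Adj]

/-- The neighbours of `b` outside `X`. -/
def outerNeighbors (Γ : SimpleGraph V) [DecidableRel Γ.Adj] (X : Finset V) (b : V) : Finset V :=
  univ.filter fun y => Γ.Adj b y ∧ y ∉ X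

lemma sum_card_outerNeighbors_le {d : ℕ} {X B : Finset V} (hB : B ⊆ X)
    (hX : (univ.filter fun p : V × V => p.1 ∈ X ∧ p.2 ∉ X ∧ Γ.Adj p.1 p.2).card ≤ d) :
    ∑ b ∈ B, (outerNeighbors Γ X b).card ≤ d := by
  rw [← card_sigma]
  refine le_trans (card_le_card_of_injOn (fun p => (p.1, p.2)) ?_ ?_) hX
  · rintro ⟨b, y⟩ h
    simp only [coe_sigma, Set.mem_sigma_iff, mem_coe, outerNeighbors, mem_univ,
      true_and, coe_filter, Set.mem_ofPred_eq] at h ⊢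
    exact ⟨hB h.1, h.2.2, h.2.1⟩
  · rintro ⟨b, y⟩ - ⟨c, z⟩ - h
    simp only [Prod.mk.injEq] at h
    obtain ⟨rfl, rfl⟩ := h
    rfl

/-- A union bound for the number of conflicts; the empty set is counted once only. -/
lemma card_conflicts_le {f : V → ℤ} {d : ℕ} (hd : 0 < d)
    (hearlier : ∀ w, (earlierNeighbors Γ f w).card ≤ d) (v : V) :
    (conflicts Γ f v).card ≤
      1 + ((laterNeighbors Γ f v).filter fun w => (neighborsBefore Γ f v w).Nonempty).card *
        (2 ^ (d - 1) - 1) := by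
  have hsub : conflicts Γ f v ⊆ insert ∅
      (((laterNeighbors Γ f v).filter fun w => (neighborsBefore Γ f v w).Nonempty).biUnion
        fun w => (neighborsBefore Γ f v w).powerset.erase ∅) := by
    intro T hT
    simp only [conflicts, mem_biUnion, mem_powerset, mem_insert, mem_filter, mem_erase] at hT ⊢
    obtain ⟨w, hw, hT⟩ := hT
    rcases eq_empty_or_nonempty T with rfl | hne
    · exact Or.inl rfl
    · exact Or.inr ⟨w, ⟨hw, hne.mono hT⟩, hne.ne_empty, hT⟩
  refine (card_le_card hsub).trans ((card_insert_le _ _).trans ?_)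
  rw [add_comm]
  refine Nat.add_le_add_left (card_biUnion_le_card_mul _ _ _ fun w hw => ?_) 1
  rw [card_erase_of_mem (by simp), card_powerset]
  refine Nat.sub_le_sub_right (Nat.pow_le_pow_right (by norm_num) ?_) 1
  have hw' := (mem_filter.1 (mem_filter.1 hw).1).2
  have hv : v ∉ neighborsBefore Γ f v w := by simp [neighborsBefore]
  have : insert v (neighborsBefore Γ f v w) ⊆ earlierNeighbors Γ f w := by
    intro u hu
    rcases mem_insert.1 hu with rfl | hu
    · simpa [earlierNeighbors] using hw'
    · simp only [neighborsBefore, mem_filter, mem_univ, true_and] at hu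
      simpa [earlierNeighbors] using ⟨hu.1, hu.2.trans hw'.2⟩
  have h1 := (card_le_card this).trans (hearlier w)
  rw [card_insert_of_notMem hv] at h1
  omega

/-- The count of conflicts for a vertex `v` when no earlier vertex lies in `S v`. -/
lemma conflict_bound_first {k a b L : ℕ} (hk : 0 < k) (hL : 2 ≤ L) (hab : a + b ≤ 2 * k) :
    (1 + b * (2 ^ (2 * k - 1) - 1)) * 2 ^ a < 2 ^ (L + 4 * k - 3) := by
  have hC : 2 ≤ 2 ^ (2 * k - 1) := by
    calc 2 = 2 ^ 1 := rfl
      _ ≤ _ := Nat.pow_le_pow_right (by norm_num) (by omega)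
  obtain ⟨C, hC'⟩ : ∃ C, 2 ^ (2 * k - 1) = C + 2 := ⟨2 ^ (2 * k - 1) - 2, by omega⟩
  have hb : b + 1 ≤ 2 ^ b := Nat.lt_two_pow_self
  have h1 : 1 + b * (2 ^ (2 * k - 1) - 1) < 2 ^ (2 * k - 1) * 2 ^ b := by
    rw [hC', show C + 2 - 1 = C + 1 by omega]
    nlinarith [Nat.mul_le_mul_left (C + 2) hb]
  calc _ < 2 ^ (2 * k - 1) * 2 ^ b * 2 ^ a := Nat.mul_lt_mul_of_pos_right h1 (by positivity)
    _ = 2 ^ (2 * k - 1 + b + a) := by rw [pow_add, pow_add]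
    _ ≤ _ := Nat.pow_le_pow_right (by norm_num) (by omega)

/-- The count of conflicts for a vertex with fewer than `k` earlier neighbours. -/
lemma conflict_bound_later {k a b n : ℕ} (hk : 0 < k) (hb : b + 1 ≤ n) (ha : a + 1 ≤ k) :
    (1 + b * (2 ^ (2 * k - 1) - 1)) * 2 ^ a < 2 ^ (Nat.log 2 n + 4 * k - 3) := by
  have hE : 2 ^ (2 * k - 1) - 1 ≤ 2 ^ (3 * k - 3) := by
    rcases Nat.lt_or_ge k 2 with h | h
    · obtain rfl : k = 1 := by omega
      norm_num
    · exact (Nat.sub_le _ _).trans (Nat.pow_le_pow_right (by norm_num) (by omega))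
  have hE1 : 1 ≤ 2 ^ (3 * k - 3) := Nat.one_le_two_pow
  have h1 : 1 + b * (2 ^ (2 * k - 1) - 1) ≤ n * 2 ^ (3 * k - 3) := by
    calc _ ≤ 2 ^ (3 * k - 3) + b * 2 ^ (3 * k - 3) :=
          Nat.add_le_add hE1 (Nat.mul_le_mul_left _ hE)
      _ = (b + 1) * 2 ^ (3 * k - 3) := by ring
      _ ≤ _ := Nat.mul_le_mul_right _ hb
  have hn : n < 2 ^ (Nat.log 2 n + 1) := Nat.lt_pow_succ_log_self (by norm_num) n
  calc _ ≤ n * 2 ^ (3 * k - 3) * 2 ^ (k - 1) :=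
        Nat.mul_le_mul h1 (Nat.pow_le_pow_right (by norm_num) (by omega))
    _ < 2 ^ (Nat.log 2 n + 1) * 2 ^ (3 * k - 3) * 2 ^ (k - 1) := by gcongr
    _ = 2 ^ (Nat.log 2 n + 1 + (3 * k - 3) + (k - 1)) := by rw [← pow_add, ← pow_add]
    _ = _ := by congr 1; omega

/-- In a graph with a hierarchy of cuts of size at most `2k` as in `exists_tight_hierarchy`,
dot products along the edges can be prescribed in dimension `log n + 4k - 3`.

The vertices are ordered by decreasing `(S v).card`, then by decreasing number of neighbours
outside `S v`. Let `v` have `a` earlier neighbours; these lie outside `S v`. If no earlier vertex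
lies in `S v`, every later neighbour of `v` that creates a nontrivial conflict uses up an edge of
the cut of `S v`, so there are at most `2k - a` of them. Otherwise an earlier vertex `u` has
`S u = S v` and at least as many outer neighbours as `v`, whence `a ≤ k`; and if `a = k`, the cut of
`S v` is exhausted and `{u}` is the only nontrivial conflict. -/
theorem exists_vectors_of_hierarchy {k : ℕ} (hk : 0 < k) (hn : 4 ≤ Fintype.card V)
    (S : V → Finset V) (hself : ∀ v, v ∈ S v) (hsub : ∀ u v, u ∈ S v → S u ⊆ S v)
    (hsep : ∀ u v, Γ.Adj u v → u ∉ S v ∨ v ∉ S u)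
    (hcut : ∀ v, (univ.filter fun p : V × V =>
      p.1 ∈ S v ∧ p.2 ∉ S v ∧ Γ.Adj p.1 p.2).card ≤ 2 * k)
    (c : V → V → ZMod 2) (hc : ∀ u v, c u v = c v u) :
    ∃ x : V → Fin (Nat.log 2 (Fintype.card V) + 4 * k - 3) → ZMod 2,
      ∀ u v, Γ.Adj u v → x u ⬝ᵥ x v = c u v := by
  set n := Fintype.card V with hndef
  set α : V → ℕ := fun v => (outerNeighbors Γ (S v) v).card with hα
  have hαn : ∀ v, α v ≤ n := fun v => card_le_univ _
  obtain ⟨f, hf, hfK⟩ := exists_injective_order fun v => (S v).card * (n + 1) + α v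
  have hcard : ∀ u v, f u < f v → (S v).card ≤ (S u).card := by
    intro u v huv
    by_contra! hlt
    have h1 := hfK u v huv
    have h2 : ((S u).card + 1) * (n + 1) ≤ (S v).card * (n + 1) := Nat.mul_le_mul_right _ hlt
    have h3 := hαn u
    rw [add_mul, one_mul] at h2
    omega
  have hclass : ∀ u v, f u < f v → u ∈ S v → S u = S v ∧ α v ≤ α u := by
    intro u v huv hu
    have h1 := eq_of_subset_of_card_le (hsub u v hu) (hcard u v huv)
    have h2 := hfK u v huv
    simp only [h1] at h2
    exact ⟨h1, by omega⟩
  have hout : ∀ v, earlierNeighbors Γ f v ⊆ outerNeighbors Γ (S v) v := by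
    intro v u hu
    simp only [earlierNeighbors, outerNeighbors, mem_filter, mem_univ, true_and] at hu ⊢
    refine ⟨hu.1.symm, fun huS => ?_⟩
    rcases hsep u v hu.1 with h | h
    · exact h huS
    · exact h ((hclass u v hu.2 huS).1 ▸ hself v)
  have hearlier : ∀ v, (earlierNeighbors Γ f v).card ≤ 2 * k := fun v => by
    have := sum_card_outerNeighbors_le (B := {v}) (by simpa using hself v) (hcut v)
    rw [sum_singleton] at this
    exact (card_le_card (hout v)).trans this
  refine exists_vectors_of_card_conflicts_lt Γ f hf _ c hc fun v => ?_
  have hconf := card_conflicts_le (by omega : 0 < 2 * k) hearlier v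
  set W := (laterNeighbors Γ f v).filter fun w => (neighborsBefore Γ f v w).Nonempty with hW
  have hL : 2 ≤ Nat.log 2 n := Nat.le_log_of_pow_le (by norm_num) (by simpa using hn)
  have hlater : ∀ w ∈ W, Γ.Adj v w ∧ f v < f w := fun w hw => by
    simpa [laterNeighbors] using (mem_filter.1 hw).1
  have hvW : v ∉ W := fun h => (hlater v h).2.false
  by_cases ha : (earlierNeighbors Γ f v).card + 1 ≤ k
  · refine (Nat.mul_le_mul_right _ hconf).trans_lt (conflict_bound_later hk ?_ ha)
    rw [← card_insert_of_notMem hvW]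
    exact card_le_univ _
  by_cases hfirst : ∃ u ∈ S v, f u < f v
  · obtain ⟨u, huS, huv⟩ := hfirst
    obtain ⟨hSu, hαu⟩ := hclass u v huv huS
    have hune : u ≠ v := fun h => by rw [h] at huv; exact huv.false
    have hav := card_le_card (hout v)
    have hαu' : α u = (outerNeighbors Γ (S v) u).card := by simp only [hα, hSu]
    have h2 := sum_card_outerNeighbors_le (B := {u, v})
      (by simp [insert_subset_iff, hself, huS]) (hcut v)
    rw [sum_pair hune] at h2
    have heq : earlierNeighbors Γ f v = outerNeighbors Γ (S v) v :=
      eq_of_subset_of_card_le (hout v) (by simp only [hα] at hαu hαu'; omega)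
    have h3 : ∀ w ∈ S v, w ≠ u → w ≠ v → (outerNeighbors Γ (S v) w).card = 0 := by
      intro w hw hwu hwv
      have := sum_card_outerNeighbors_le (B := {w, u, v})
        (by simp [insert_subset_iff, hself, huS, hw]) (hcut v)
      rw [sum_insert (by simp [hwu, hwv]), sum_pair hune] at this
      simp only [hα] at hαu hαu'
      omega
    have hsubset : conflicts Γ f v ⊆ {∅, {u}} := by
      intro T hT
      simp only [conflicts, laterNeighbors, mem_biUnion, mem_powerset, mem_filter, mem_univ,
        true_and] at hT
      obtain ⟨w, ⟨hvw, hfvw⟩, hT⟩ := hT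
      have hwS : w ∈ S v := by
        by_contra hwS
        have : w ∈ earlierNeighbors Γ f v := by
          rw [heq]; simp [outerNeighbors, hvw, hwS]
        simp only [earlierNeighbors, mem_filter] at this
        exact this.2.2.asymm hfvw
      have : T ⊆ {u} := by
        intro u' hu'
        have := hT hu'
        simp only [neighborsBefore, mem_filter, mem_univ, true_and] at this
        obtain ⟨hadj, hlt⟩ := this
        by_contra hne
        rw [mem_singleton] at hne
        by_cases hu'S : u' ∈ S v
        · have h4 := hclass u' v hlt hu'S
          have h5 := h3 u' hu'S hne (fun h => by rw [h] at hlt; exact hlt.false)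
          have h6 : α u' = 0 := by simp only [hα, h4.1, h5]
          have h7 := h4.2
          simp only [hα] at h6 h7
          omega
        · have h4 := h3 w hwS (fun h => by rw [h] at hfvw; exact hfvw.asymm huv)
            (fun h => hvw.ne h.symm)
          rw [card_eq_zero] at h4
          have : u' ∈ outerNeighbors Γ (S v) w := by simp [outerNeighbors, hadj.symm, hu'S]
          rw [h4] at this
          simp at this
      rcases subset_singleton_iff.1 this with h | h <;> simp [h]
    have hcard2 : (conflicts Γ f v).card ≤ 2 := (card_le_card hsubset).trans card_le_two
    have hak : (earlierNeighbors Γ f v).card ≤ k := by simp only [hα] at hαu hαu'; omega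
    calc _ ≤ 2 * 2 ^ k := Nat.mul_le_mul hcard2 (Nat.pow_le_pow_right (by norm_num) hak)
      _ = 2 ^ (k + 1) := by ring
      _ < _ := Nat.pow_lt_pow_right (by norm_num) (by omega)
  · push Not at hfirst
    refine (Nat.mul_le_mul_right _ hconf).trans_lt (conflict_bound_first hk hL ?_)
    have h1 := sum_card_outerNeighbors_le (B := insert v (W.filter fun w => w ∈ S v))
      (by
        intro w hw
        rcases mem_insert.1 hw with rfl | hw
        · exact hself _
        · exact (mem_filter.1 hw).2) (hcut v)
    rw [sum_insert (by simp [hvW])] at h1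
    have h2 : (W.filter fun w => w ∈ S v).card ≤
        ∑ w ∈ W.filter (fun w => w ∈ S v), (outerNeighbors Γ (S v) w).card := by
      rw [card_eq_sum_ones]
      refine sum_le_sum fun w hw => card_pos.2 ?_
      obtain ⟨u, hu⟩ := (mem_filter.1 (mem_filter.1 hw).1).2
      simp only [neighborsBefore, mem_filter, mem_univ, true_and] at hu
      exact ⟨u, by simpa [outerNeighbors] using ⟨hu.1.symm, fun h => (hfirst u h).not_gt hu.2⟩⟩
    have h3 : (earlierNeighbors Γ f v).card + (W.filter fun w => w ∉ S v).card ≤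
        (outerNeighbors Γ (S v) v).card := by
      rw [← card_union_of_disjoint]
      · refine card_le_card (union_subset (hout v) fun w hw => ?_)
        rw [mem_filter] at hw
        simpa [outerNeighbors] using ⟨(hlater w hw.1).1, hw.2⟩
      · rw [disjoint_left]
        intro w hw hw'
        simp only [earlierNeighbors, mem_filter] at hw
        exact hw.2.2.asymm (hlater w (mem_filter.1 hw').1).2
    have h4 := card_filter_add_card_filter_not (s := W) (fun w => w ∈ S v)
    omega

end Ordering

/-! ### Families of inversions -/

section Inversions

open scoped Classical in
/-- The parity of the number of members of `Xs` that contain both `u` and `v`. -/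
noncomputable def flips {V : Type*} (Xs : List (Set V)) (u v : V) : ZMod 2 :=
  (Xs.map fun X => if u ∈ X ∧ v ∈ X then 1 else 0).sum

lemma invertFamily_adj {V : Type*} (D : Digraph V) (Xs : List (Set V)) (u v : V) :
    (invertFamily D Xs).Adj u v ↔ (flips Xs u v = 0 ∧ D.Adj u v) ∨
      (flips Xs u v ≠ 0 ∧ D.Adj v u) := by
  induction Xs generalizing D with
  | nil => simp [invertFamily, flips]
  | cons X Xs ih =>
    have h1 : invertFamily D (X :: Xs) = invertFamily (invert D X) Xs := rfl
    have h01 : ∀ z : ZMod 2, z = 0 ∨ z = 1 := by decide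
    have h2 : (1 + 1 : ZMod 2) = 0 := by decide
    rw [h1, ih]
    by_cases huv : u ∈ X ∧ v ∈ X
    · have h3 : flips (X :: Xs) u v = 1 + flips Xs u v := by simp [flips, huv]
      rw [h3]
      rcases h01 (flips Xs u v) with h | h <;> simp [h, h2, invert, huv]
    · have h3 : flips (X :: Xs) u v = flips Xs u v := by simp [flips, huv]
      have h4 : (invert D X).Adj u v ↔ D.Adj u v := by
        simp only [invert, huv, false_and, not_false_eq_true, true_and, false_or]
      have h5 : (invert D X).Adj v u ↔ D.Adj v u := by
        simp only [invert, and_comm (a := v ∈ X), huv, false_and, not_false_eq_true, true_and,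
          false_or]
      rw [h3, h4, h5]

lemma flips_ofFn {V : Type*} {t : ℕ} (x : V → Fin t → ZMod 2) (u v : V) :
    flips (List.ofFn fun i => {w | x w i = 1}) u v = x u ⬝ᵥ x v := by
  have : ∀ a b : ZMod 2, (if a = 1 ∧ b = 1 then (1 : ZMod 2) else 0) = a * b := by decide
  simp only [flips, List.map_ofFn, List.sum_ofFn, dotProduct, Function.comp_def,
    Set.mem_ofPred_eq, ← this]
  congr!

end Inversions

/-! ### The upper bound -/

section UpperBound

open Finset

variable {V : Type*} [Fintype V]

open scoped Classical in
/-- The underlying multigraph of a digraph as a multiset of edges. -/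
noncomputable def edgeMultiset (D : Digraph V) : Multiset (Sym2 V) :=
  (univ.filter fun p : V × V => D.Adj p.1 p.2).val.map fun p => s(p.1, p.2)

lemma adj_or_adj_of_mem_edgeMultiset {D : Digraph V} {u v : V} (h : s(u, v) ∈ edgeMultiset D) :
    D.Adj u v ∨ D.Adj v u := by
  classical
  simp only [edgeMultiset, Multiset.mem_map, mem_val, mem_filter, mem_univ, true_and] at h
  obtain ⟨⟨a, b⟩, hab, he⟩ := h
  rcases Sym2.eq_iff.1 he with ⟨rfl, rfl⟩ | ⟨rfl, rfl⟩
  · exact Or.inl hab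
  · exact Or.inr hab

variable [DecidableEq V]

lemma exists_vectors_of_card_eq_three {Γ : SimpleGraph V} (hV : Fintype.card V = 3)
    (c : V → V → ZMod 2) (hc : ∀ u v, c u v = c v u) :
    ∃ x : V → Fin 2 → ZMod 2, ∀ u v, Γ.Adj u v → x u ⬝ᵥ x v = c u v := by
  obtain ⟨e⟩ := Fintype.truncEquivFinOfCardEq hV
  have hsymm : ∀ i, e (e.symm i) = i := e.apply_symm_apply
  set p := c (e.symm 0) (e.symm 1) with hp
  set q := c (e.symm 0) (e.symm 2) with hq
  set r := c (e.symm 1) (e.symm 2) with hr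
  refine ⟨fun v => ![![1, 0], ![p, 1], ![q, r - p * q]] (e v), fun u v huv => ?_⟩
  obtain ⟨i, rfl⟩ := e.symm.surjective u
  obtain ⟨j, rfl⟩ := e.symm.surjective v
  have hne : i ≠ j := fun h => huv.ne (by rw [h])
  simp only [hsymm]
  fin_cases i <;> fin_cases j <;>
    simp [dotProduct, Fin.sum_univ_two] at hne ⊢
  · exact hp
  · exact hq
  · rw [hp, hc]
  · rw [← hr]
  · rw [hc, ← hq]
  · rw [hc, ← hr]; ring

lemma exists_minimal_edgeConnOn {k : ℕ} {U : Finset V} (G : Multiset (Sym2 V))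
    (hG : EdgeConnOn k U G) :
    ∃ H ≤ G, EdgeConnOn k U H ∧ ∀ e H', H = e ::ₘ H' → ¬ EdgeConnOn k U H' := by
  induction hc : G.card using Nat.strong_induction_on generalizing G with
  | _ c ih =>
  by_cases hmin : ∃ e H', G = e ::ₘ H' ∧ EdgeConnOn k U H'
  · obtain ⟨e, H', rfl, hH'⟩ := hmin
    obtain ⟨H, h1, h2, h3⟩ := ih H'.card (by rw [← hc]; simp) H' hH' rfl
    exact ⟨H, h1.trans (Multiset.le_cons_self _ _), h2, h3⟩
  · push Not at hmin
    exact ⟨G, le_rfl, hG, hmin⟩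

lemma edgeConnOn_edgeMultiset {D : Digraph V} {k : ℕ}
    (h : IsEdgeConnected k (underlyingMultigraph D)) :
    EdgeConnOn k univ (edgeMultiset D) := by
  classical
  intro X _ hX hX'
  have hXc : (Xᶜ : Finset V).Nonempty := by
    rw [← Finset.compl_ne_univ_iff_nonempty, compl_compl]; exact hX'
  have h1 := h X (Xᶜ : Finset V) (by simpa using hX) (coe_nonempty.2 hXc)
    (by rw [disjoint_coe]; exact disjoint_compl_right)
    (by rw [← coe_union, union_compl]; simp [underlyingMultigraph])
  have h2 : {e : V × V | ∃ x ∈ (X : Set V), ∃ y ∈ ((Xᶜ : Finset V) : Set V),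
      (underlyingMultigraph D).IsLink e x y} ⊆
      ((univ.filter fun p : V × V => D.Adj p.1 p.2).filter fun p => ¬ (p.1 ∈ X ↔ p.2 ∈ X) :
        Finset (V × V)) := by
    rintro e ⟨x, hx, y, hy, hD, he⟩
    simp only [mem_coe, mem_compl] at hx hy
    simp only [coe_filter, mem_filter, mem_univ, true_and, Set.mem_ofPred_eq]
    rcases he with rfl | rfl <;> simp_all
  have h3 := h1.trans (Set.encard_le_encard h2)
  rw [Set.encard_coe_eq_coe_finsetCard, Nat.cast_le] at h3
  refine h3.trans (le_of_eq ?_)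
  rw [edgeMultiset, cutSize, Multiset.map_map, card_filter]
  refine sum_congr rfl fun p _ => ?_
  by_cases h1 : p.1 ∈ X <;> by_cases h2 : p.2 ∈ X <;> simp [h1, h2]

lemma count_edgeMultiset_le (D : Digraph V) (u v : V) :
    (edgeMultiset D).count s(u, v) ≤ 2 ∧
      (2 ≤ (edgeMultiset D).count s(u, v) → D.Adj u v ∧ D.Adj v u) := by
  classical
  set A := (univ.filter fun p : V × V => D.Adj p.1 p.2).filter fun p => s(u, v) = s(p.1, p.2)
    with hA
  have h1 : (edgeMultiset D).count s(u, v) = A.card := by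
    rw [edgeMultiset, Multiset.count_map]; rfl
  have h2 : A ⊆ {(u, v), (v, u)} := by
    rintro ⟨a, b⟩ h
    have := (mem_filter.1 h).2
    rcases Sym2.eq_iff.1 this with ⟨rfl, rfl⟩ | ⟨rfl, rfl⟩ <;> simp
  rw [h1]
  refine ⟨(card_le_card h2).trans card_le_two, fun h => ?_⟩
  have h3 := eq_of_subset_of_card_le h2 (card_le_two.trans h)
  have h4 : (u, v) ∈ A := by rw [h3]; simp
  have h5 : (v, u) ∈ A := by rw [h3]; simp
  exact ⟨(mem_filter.1 (mem_filter.1 h4).1).2, (mem_filter.1 (mem_filter.1 h5).1).2⟩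

lemma cutSize_le_card_of_nodup {Q : Multiset (Sym2 V)} (hQ : Q.Nodup) (X : Finset V) :
    cutSize Q X ≤
      (univ.filter fun p : V × V => p.1 ∈ X ∧ p.2 ∉ X ∧ s(p.1, p.2) ∈ Q).card := by
  have h1 : cutSize Q X = ∑ e ∈ (⟨Q, hQ⟩ : Finset (Sym2 V)), crossing X e := rfl
  have h2 : ∀ e, crossing X e = if crossing X e = 1 then 1 else 0 := by
    intro e; induction e using Sym2.ind; simp only [crossing_mk]; split_ifs <;> simp_all
  rw [h1, sum_congr rfl fun e _ => h2 e, ← card_filter]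
  refine le_trans (card_le_card (t := (univ.filter fun p : V × V =>
    p.1 ∈ X ∧ p.2 ∉ X ∧ s(p.1, p.2) ∈ Q).image fun p => s(p.1, p.2)) ?_) card_image_le
  intro e he
  rw [mem_filter] at he
  obtain ⟨he, hX⟩ := he
  have he' : e ∈ Q := he
  induction e using Sym2.ind with
  | _ a b =>
    rw [mem_image]
    by_cases ha : a ∈ X <;> by_cases hb : b ∈ X
    · simp [ha, hb] at hX
    · exact ⟨(a, b), by simp [ha, hb, he'], rfl⟩
    · exact ⟨(b, a), by simp [ha, hb, Sym2.eq_swap (a := b), he'], Sym2.eq_swap⟩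
    · simp [ha, hb] at hX

lemma exists_nodup_add_of_count_le_two {α : Type*} [DecidableEq α] (G : Multiset α)
    (h : ∀ e, G.count e ≤ 2) :
    ∃ P Q : Multiset α, G = P + Q + Q ∧ P.Nodup ∧ Q.Nodup ∧ Disjoint P Q := by
  refine ⟨G.dedup.filter fun e => G.count e = 1, G.dedup.filter fun e => G.count e = 2, ?_,
    G.nodup_dedup.filter _, G.nodup_dedup.filter _, ?_⟩
  · ext e
    have h1 := h e
    have h2 : G.count e = 0 ↔ e ∉ G := Multiset.count_eq_zero
    simp only [Multiset.count_add, Multiset.count_filter, Multiset.count_dedup]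
    by_cases he : e ∈ G
    · have : G.count e ≠ 0 := by simpa [h2] using he
      simp only [he, if_true]
      split_ifs <;> omega
    · simp [he]
  · rw [Multiset.disjoint_left]
    intro e h1 h2
    have h1 := (Multiset.mem_filter.1 h1).2
    have h2 := (Multiset.mem_filter.1 h2).2
    omega

/-- Every `2k`-edge-connected digraph of order `n` becomes `k`-arc-strong after
`log n + 4k - 3` inversions: in an edge-minimal `2k`-edge-connected sub-multigraph, the inversions
prescribed by vectors over `ZMod 2` produce the orientation of `exists_arcStrong_orientation`. -/
theorem exists_inversions {k : ℕ} (hk : 0 < k) (hn : k + 2 ≤ Fintype.card V)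
    {D : Digraph V} (hloop : IsLoopless D)
    (hD : IsEdgeConnected (2 * k) (underlyingMultigraph D)) :
    ∃ Xs : List (Set V), Xs.length = Nat.log 2 (Fintype.card V) + 4 * k - 3 ∧
      IsArcStrong k (invertFamily D Xs) := by
  classical
  obtain ⟨G, hG0, hconn, hmin⟩ := exists_minimal_edgeConnOn _ (edgeConnOn_edgeMultiset hD)
  have hadj : ∀ u v, s(u, v) ∈ G → D.Adj u v ∨ D.Adj v u := fun u v h =>
    adj_or_adj_of_mem_edgeMultiset (Multiset.mem_of_le hG0 h)
  have hcount : ∀ u v, G.count s(u, v) ≤ 2 ∧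
      (2 ≤ G.count s(u, v) → D.Adj u v ∧ D.Adj v u) := fun u v =>
    ⟨(Multiset.count_le_of_le _ hG0).trans (count_edgeMultiset_le D u v).1,
      fun h => (count_edgeMultiset_le D u v).2 (h.trans (Multiset.count_le_of_le _ hG0))⟩
  obtain ⟨P, Q, hPQ, hP, hQ, hdisj⟩ := exists_nodup_add_of_count_le_two G
    (fun e => by induction e using Sym2.ind; exact (hcount _ _).1)
  obtain ⟨O, hO, hOout⟩ := exists_arcStrong_orientation hk P Q (hPQ ▸ hconn)
  have hPG : ∀ e ∈ P, e ∈ G := fun e he => by rw [hPQ]; simp [he]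
  have hQadj : ∀ u v, s(u, v) ∈ Q → D.Adj u v ∧ D.Adj v u := by
    intro u v h
    refine (hcount u v).2 ?_
    have := Multiset.one_le_count_iff_mem.2 h
    rw [hPQ, Multiset.count_add, Multiset.count_add]
    omega
  have hne : ∀ u v, s(u, v) ∈ G → u ≠ v := by
    rintro u v h rfl
    rcases hadj u u h with h | h <;> exact hloop u h
  have hOP : ∀ u v, (u, v) ∈ O → s(u, v) ∈ P := fun u v h => by
    rw [← hO]; exact Multiset.mem_map_of_mem _ h
  have hOnodup : O.Nodup := Multiset.Nodup.of_map _ (hO ▸ hP)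
  have hOanti : ∀ u v, (u, v) ∈ O → (v, u) ∉ O := by
    intro u v h1 h2
    have := Multiset.inj_on_of_nodup_map (hO ▸ hP) (u, v) h1 (v, u) h2 Sym2.eq_swap
    exact hne u v (hPG _ (hOP u v h1)) (Prod.mk.inj this).1
  -- the graph of the edges whose direction matters
  let Γ : SimpleGraph V :=
    { Adj := fun u v => s(u, v) ∈ P
      symm := ⟨fun u v h => by rwa [Sym2.eq_swap]⟩
      loopless := ⟨fun u h => hne u u (hPG _ h) rfl⟩ }
  let c : V → V → ZMod 2 := fun u v =>
    if ((u, v) ∈ O ∧ D.Adj u v) ∨ ((v, u) ∈ O ∧ D.Adj v u) then 0 else 1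
  have hc : ∀ u v, c u v = c v u := fun u v => by simp only [c, or_comm]
  obtain ⟨x, hx⟩ : ∃ x : V → Fin (Nat.log 2 (Fintype.card V) + 4 * k - 3) → ZMod 2,
      ∀ u v, Γ.Adj u v → x u ⬝ᵥ x v = c u v := by
    rcases Nat.lt_or_ge (Fintype.card V) 4 with h | h
    · have h3 : Fintype.card V = 3 := by omega
      have h4 : Nat.log 2 (Fintype.card V) + 4 * k - 3 = 2 := by
        have : Nat.log 2 3 = 1 := by norm_num [Nat.log_eq_iff]
        rw [h3, this]; omega
      rw [h4]
      exact exists_vectors_of_card_eq_three h3 c hc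
    · obtain ⟨S, h1, h2, h3, h4⟩ := exists_tight_hierarchy hconn hmin
      refine exists_vectors_of_hierarchy hk h S h1 h2 (fun u v huv => h3 u v (hPG _ huv))
        (fun v => ?_) c hc
      refine le_trans (card_le_card fun p hp => ?_) ((card_cut_le_cutSize G (S v)).trans (h4 v))
      simp only [mem_filter, mem_univ, true_and] at hp ⊢
      exact ⟨hp.1, hp.2.1, hPG _ hp.2.2⟩
  set Xs := List.ofFn fun i => {w | x w i = 1} with hXs
  have hflip : ∀ u v, flips Xs u v = x u ⬝ᵥ x v := flips_ofFn x
  have harcO : ∀ u v, (u, v) ∈ O → (invertFamily D Xs).Adj u v := by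
    intro u v h
    rw [invertFamily_adj, hflip, hx u v (hOP u v h)]
    simp only [c, h, hOanti u v h, true_and, false_and, or_false]
    rcases hadj u v (hPG _ (hOP u v h)) with h1 | h1
    · simp [h1]
    · by_cases h2 : D.Adj u v <;> simp [h1, h2]
  have harcQ : ∀ u v, s(u, v) ∈ Q → (invertFamily D Xs).Adj u v := by
    intro u v h
    rw [invertFamily_adj]
    have := hQadj u v h
    tauto
  refine ⟨Xs, by simp [hXs], ?_⟩
  intro V₁ V₂ hV₁ hV₂ hdis hun
  have hV₂eq : ∀ v, v ∈ V₂ ↔ v ∉ V₁ := fun v =>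
    ⟨fun h h' => Set.disjoint_left.1 hdis h' h, fun h =>
      ((Set.mem_union _ _ _).1 (hun ▸ Set.mem_univ v)).resolve_left h⟩
  set X := V₁.toFinset with hXdef
  have hkX := hOout X (by simpa [hXdef] using hV₁) (fun h => by
    obtain ⟨v, hv⟩ := hV₂
    have : v ∈ X := h ▸ mem_univ v
    exact (hV₂eq v).1 hv (by simpa [hXdef] using this))
  set A₁ : Finset (V × V) := (⟨O, hOnodup⟩ : Finset (V × V)).filter fun p => p.1 ∈ X ∧ p.2 ∉ X
  set A₂ : Finset (V × V) := univ.filter fun p => p.1 ∈ X ∧ p.2 ∉ X ∧ s(p.1, p.2) ∈ Q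
  have hA₁ : A₁.card = outSize O X := by
    rw [outSize, Multiset.countP_eq_card_filter]; rfl
  have hA₂ : cutSize Q X ≤ A₂.card := cutSize_le_card_of_nodup hQ X
  have hA : Disjoint A₁ A₂ := by
    rw [Finset.disjoint_left]
    rintro ⟨u, v⟩ h1 h2
    exact Multiset.disjoint_left.1 hdisj (hOP u v (mem_filter.1 h1).1) (mem_filter.1 h2).2.2.2
  have hle : k ≤ (A₁ ∪ A₂).card := by
    rw [card_union_of_disjoint hA]; omega
  calc (k : ℕ∞) ≤ ((A₁ ∪ A₂).card : ℕ∞) := by exact_mod_cast hle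
    _ = ((A₁ ∪ A₂ : Finset (V × V)) : Set (V × V)).encard :=
      (Set.encard_coe_eq_coe_finsetCard _).symm
    _ ≤ _ := Set.encard_le_encard ?_
  rintro ⟨u, v⟩ h
  rcases mem_union.1 (mem_coe.1 h) with h | h
  · obtain ⟨h1, h2, h3⟩ := mem_filter.1 h
    exact ⟨by simpa [hXdef] using h2, (hV₂eq v).2 (by simpa [hXdef] using h3), harcO u v h1⟩
  · obtain ⟨-, h2, h3, h4⟩ := mem_filter.1 h
    exact ⟨by simpa [hXdef] using h2, (hV₂eq v).2 (by simpa [hXdef] using h3), harcQ u v h4⟩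

end UpperBound

/-! ### The lower bound -/

section LowerBound

open Finset

/-- The digraph behind the lower bound. The vertices in `U` are joined to all others by digons.
A vertex `v` outside `U` carries a pair `(a v, b v)`: it is a hub if `a v = b v`, and otherwise a
sink that receives an arc from each hub whose label is `a v` or `b v`. -/
def hubDigraph {V I : Type*} (U : Finset V) (a b : V → I) : Digraph V where
  Adj u v := u ≠ v ∧ (u ∈ U ∨ v ∈ U ∨ (a u = b u ∧ a v ≠ b v ∧ (a u = a v ∨ a u = b v)))

variable {V : Type*} [DecidableEq V]

section Hubs

variable {I : Type*} {U : Finset V} {a b : V → I} {h : I → V}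

/-- The part of `hubDigraph U a b` outside `U` is 2-edge-connected: two hubs `i` and `j` on
different sides of a cut are joined by two paths, through the sinks labelled `(i, j)` and `(j, i)`. -/
lemma exists_two_crossing_arcs (hU : ∀ i, h i ∉ U) (ha : ∀ i, a (h i) = i)
    (hb : ∀ i, b (h i) = i) (huniq : ∀ u ∉ U, a u = b u → u = h (a u))
    (hpair : ∀ i j, i ≠ j → ∃ v ∉ U, a v = i ∧ b v = j) (X : Finset V)
    (hX : ∃ p ∉ U, p ∈ X) (hX' : ∃ q ∉ U, q ∉ X) :
    ∃ e₁ e₂ : V × V, e₁ ≠ e₂ ∧ ∀ e, e = e₁ ∨ e = e₂ → (hubDigraph U a b).Adj e.1 e.2 ∧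
      ¬ (e.1 ∈ X ↔ e.2 ∈ X) ∧ e.1 ∉ U ∧ e.2 ∉ U := by
  have harc : ∀ v ∉ U, a v ≠ b v → ∀ i, i = a v ∨ i = b v →
      (hubDigraph U a b).Adj (h i) v := by
    intro v _ hab i hi
    refine ⟨?_, Or.inr (Or.inr ⟨by rw [ha, hb], hab, by rwa [ha]⟩)⟩
    rintro rfl
    exact hab (by rw [ha, hb])
  by_cases hsplit : ∃ i j, h i ∈ X ∧ h j ∉ X
  · obtain ⟨i, j, hi, hj⟩ := hsplit
    have hij : i ≠ j := fun h => by rw [h] at hi; exact hj hi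
    have key : ∀ v ∉ U, a v ≠ b v → (i = a v ∨ i = b v) → (j = a v ∨ j = b v) →
        ∃ e : V × V, e.2 = v ∧ (hubDigraph U a b).Adj e.1 e.2 ∧
          ¬ (e.1 ∈ X ↔ e.2 ∈ X) ∧ e.1 ∉ U ∧ e.2 ∉ U := by
      intro v hv hab h1 h2
      by_cases hvX : v ∈ X
      · exact ⟨(h j, v), rfl, harc v hv hab j h2, by simp [hj, hvX], hU j, hv⟩
      · exact ⟨(h i, v), rfl, harc v hv hab i h1, by simp [hi, hvX], hU i, hv⟩
    obtain ⟨v, hv, hav, hbv⟩ := hpair i j hij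
    obtain ⟨w, hw, haw, hbw⟩ := hpair j i hij.symm
    obtain ⟨e₁, h1, h1'⟩ := key v hv (by rwa [hav, hbv]) (Or.inl hav.symm) (Or.inr hbv.symm)
    obtain ⟨e₂, h2, h2'⟩ := key w hw (by rw [haw, hbw]; exact hij.symm) (Or.inr hbw.symm)
      (Or.inl haw.symm)
    refine ⟨e₁, e₂, ?_, ?_⟩
    · rintro rfl
      rw [← h1, h2, haw] at hav
      exact hij hav.symm
    · rintro e (rfl | rfl)
      exacts [h1', h2']
  · push Not at hsplit
    have key : ∀ v ∉ U, (∀ i, ¬ (h i ∈ X ↔ v ∈ X)) →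
        ∃ e₁ e₂ : V × V, e₁ ≠ e₂ ∧ ∀ e, e = e₁ ∨ e = e₂ → (hubDigraph U a b).Adj e.1 e.2 ∧
          ¬ (e.1 ∈ X ↔ e.2 ∈ X) ∧ e.1 ∉ U ∧ e.2 ∉ U := by
      intro v hv hvX
      have hab : a v ≠ b v := fun hab => by
        have := hvX (a v)
        rw [← huniq v hv hab] at this
        exact this Iff.rfl
      refine ⟨(h (a v), v), (h (b v), v), ?_, ?_⟩
      · intro heq
        have := congrArg (fun e : V × V => a e.1) heq
        simp only [ha] at this
        exact hab this
      · rintro e (rfl | rfl)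
        · exact ⟨harc v hv hab _ (Or.inl rfl), hvX _, hU _, hv⟩
        · exact ⟨harc v hv hab _ (Or.inr rfl), hvX _, hU _, hv⟩
    obtain ⟨p, hpU, hpX⟩ := hX
    obtain ⟨q, hqU, hqX⟩ := hX'
    by_cases hall : ∃ i, h i ∈ X
    · obtain ⟨i, hi⟩ := hall
      exact key q hqU fun j => by simp [hqX, hsplit i j hi]
    · push Not at hall
      exact key p hpU fun j => by simp [hpX, hall j]

/-- The vertices of `U` are too few to absorb the arcs that leave `v`. -/
lemma exists_arc_out {D : Digraph V} {k : ℕ} (hk : U.card + 1 = k) (hD : IsArcStrong k D)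
    {v : V} (hne : ∃ w, w ≠ v) : ∃ y ∉ U, D.Adj v y := by
  by_contra! hno
  have h1 := hD {v} {v}ᶜ (by simp) (by simpa [Set.Nonempty] using hne) disjoint_compl_right
    (Set.union_compl_self _)
  have h2 : {p : V × V | p.1 ∈ ({v} : Set V) ∧ p.2 ∈ ({v} : Set V)ᶜ ∧ D.Adj p.1 p.2} ⊆
      (U.image fun z => (v, z) : Finset (V × V)) := by
    rintro ⟨x, y⟩ ⟨hx, -, hxy⟩
    obtain rfl : x = v := hx
    by_contra hmem
    exact hno y (fun hy => hmem (by simpa using hy)) hxy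
  have h3 := h1.trans (Set.encard_le_encard h2)
  rw [Set.encard_coe_eq_coe_finsetCard, Nat.cast_le] at h3
  have := card_image_le (s := U) (f := fun z => (v, z))
  omega

lemma exists_arc_in {D : Digraph V} {k : ℕ} (hk : U.card + 1 = k) (hD : IsArcStrong k D)
    {v : V} (hne : ∃ w, w ≠ v) : ∃ y ∉ U, D.Adj y v := by
  by_contra! hno
  have h1 := hD {v}ᶜ {v} (by simpa [Set.Nonempty] using hne) (by simp) disjoint_compl_left
    (Set.compl_union_self _)
  have h2 : {p : V × V | p.1 ∈ ({v} : Set V)ᶜ ∧ p.2 ∈ ({v} : Set V) ∧ D.Adj p.1 p.2} ⊆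
      (U.image fun z => (z, v) : Finset (V × V)) := by
    rintro ⟨x, y⟩ ⟨-, hy, hxy⟩
    obtain rfl : y = v := hy
    by_contra hmem
    exact hno x (fun hx => hmem (by simpa using hx)) hxy
  have h3 := h1.trans (Set.encard_le_encard h2)
  rw [Set.encard_coe_eq_coe_finsetCard, Nat.cast_le] at h3
  have := card_image_le (s := U) (f := fun z => (z, v))
  omega

/-- Each hub must lie in some inverted set, as it would otherwise stay a source up to digons; and
two hubs must not lie in exactly the same inverted sets, because a sink attached to both would keep
all its arcs pointing in one direction. Hence the hubs have distinct nonempty membership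
patterns. -/
lemma card_hubs_lt [Fintype I] [Nontrivial I] {k : ℕ} (hk : U.card + 1 = k)
    (hU : ∀ i, h i ∉ U) (ha : ∀ i, a (h i) = i)
    (hb : ∀ i, b (h i) = i) (huniq : ∀ u ∉ U, a u = b u → u = h (a u))
    (hpair : ∀ i j, i ≠ j → ∃ v ∉ U, a v = i ∧ b v = j) (Xs : List (Set V))
    (hXs : IsArcStrong k (invertFamily (hubDigraph U a b) Xs)) :
    Fintype.card I < 2 ^ Xs.length := by
  classical
  have hflips : ∀ u v, flips Xs u v = flips Xs v u := fun u v => by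
    rw [flips, flips]
    congr 2
    ext X
    simp only [and_comm]
  have hhub : ∀ u ∉ U, ∀ i, ¬ (hubDigraph U a b).Adj u (h i) := by
    rintro u hu i ⟨-, h1 | h1 | h1⟩
    · exact hu h1
    · exact hU i h1
    · exact h1.2.1 (by rw [ha, hb])
  have hhinj : Function.Injective h := Function.LeftInverse.injective ha
  obtain ⟨i₀, i₁, hi⟩ := exists_pair_ne I
  have hne : ∀ v : V, ∃ w, w ≠ v := fun v => by
    by_cases hv : h i₀ = v
    · exact ⟨h i₁, fun h1 => hi (hhinj (hv.trans h1.symm))⟩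
    · exact ⟨h i₀, hv⟩
  let r : I → Fin Xs.length → Bool := fun i l => decide (h i ∈ Xs.get l)
  have hr : Function.Injective r := by
    intro i j hij
    by_contra hne'
    have hmem : ∀ X ∈ Xs, h i ∈ X ↔ h j ∈ X := by
      intro X hX
      obtain ⟨l, rfl⟩ := List.get_of_mem hX
      simpa [r] using congrFun hij l
    obtain ⟨v, hv, hav, hbv⟩ := hpair i j hne'
    have hflip : flips Xs (h i) v = flips Xs (h j) v := by
      rw [flips, flips]
      congr 1
      exact List.map_congr_left fun X hX => by simp only [hmem X hX]
    -- the neighbours of the sink `v` outside `U` are the hubs `h i` and `h j`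
    have hsink : ∀ u ∉ U, ¬ (hubDigraph U a b).Adj v u := by
      rintro u hu ⟨-, h1 | h1 | h1⟩
      · exact hv h1
      · exact hu h1
      · exact hne' (by rw [← hav, ← hbv, h1.1])
    have hnbr : ∀ u ∉ U, (hubDigraph U a b).Adj u v → flips Xs u v = flips Xs (h i) v := by
      rintro u hu ⟨-, h1 | h1 | h1⟩
      · exact absurd h1 hu
      · exact absurd h1 hv
      · rw [huniq u hu h1.1]
        rcases h1.2.2 with h2 | h2
        · rw [h2, hav]
        · rw [h2, hbv, hflip]
    obtain ⟨y, hy, hvy⟩ := exists_arc_out hk hXs (hne v)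
    obtain ⟨z, hz, hzv⟩ := exists_arc_in hk hXs (hne v)
    rw [invertFamily_adj] at hvy hzv
    have h1 := hsink y hy
    have h2 := hsink z hz
    have h3 : flips Xs (h i) v ≠ 0 := by
      rcases hvy with hvy | hvy
      · exact absurd hvy.2 h1
      · rw [← hnbr y hy hvy.2, hflips]; exact hvy.1
    rcases hzv with hzv | hzv
    · exact h3 (by rw [← hnbr z hz hzv.2]; exact hzv.1)
    · exact h2 hzv.2
  have hr0 : (fun _ => false) ∉ Set.range r := by
    rintro ⟨i, hri⟩
    obtain ⟨y, hy, hyi⟩ := exists_arc_in hk hXs (hne (h i))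
    rw [invertFamily_adj] at hyi
    rcases hyi with hyi | hyi
    · exact hhub y hy i hyi.2
    · refine hyi.1 (List.sum_eq_zero fun c hc => ?_)
      obtain ⟨X, hX, rfl⟩ := List.mem_map.1 hc
      obtain ⟨l, rfl⟩ := List.get_of_mem hX
      have : h i ∉ Xs.get l := by simpa [r] using congrFun hri l
      rw [if_neg fun h => this h.2]
  have := Fintype.card_lt_of_injective_of_notMem r hr hr0
  simpa using this

variable [Fintype V]

lemma isEdgeConnected_of_cuts {D : Digraph V} {k : ℕ}
    (h : ∀ X : Finset V, X.Nonempty → Xᶜ.Nonempty → ∃ E : Finset (V × V), k ≤ E.card ∧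
      ∀ p ∈ E, D.Adj p.1 p.2 ∧ ¬ (p.1 ∈ X ↔ p.2 ∈ X)) :
    IsEdgeConnected k (underlyingMultigraph D) := by
  classical
  intro V₁ V₂ hV₁ hV₂ hdis hun
  have hV₂eq : ∀ v, v ∈ V₂ ↔ v ∉ V₁ := fun v =>
    ⟨fun h h' => Set.disjoint_left.1 hdis h' h, fun h =>
      ((Set.mem_union _ _ _).1 (hun ▸ Set.mem_univ v)).resolve_left h⟩
  obtain ⟨E, hE, hE'⟩ := h V₁.toFinset (by simpa using hV₁) (by
    obtain ⟨v, hv⟩ := hV₂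
    exact ⟨v, by simpa using (hV₂eq v).1 hv⟩)
  calc (k : ℕ∞) ≤ (E.card : ℕ∞) := by exact_mod_cast hE
    _ = (E : Set (V × V)).encard := (Set.encard_coe_eq_coe_finsetCard _).symm
    _ ≤ _ := Set.encard_le_encard ?_
  rintro ⟨u, v⟩ hp
  obtain ⟨h1, h2⟩ := hE' _ hp
  simp only [Set.mem_toFinset] at h2
  by_cases hu : u ∈ V₁
  · exact ⟨u, hu, v, (hV₂eq v).2 (by tauto), h1, Or.inl rfl⟩
  · exact ⟨v, by tauto, u, (hV₂eq u).2 hu, h1, Or.inr rfl⟩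

/-- The pairs of vertices separated by `X`, in both orders. -/
lemma exists_card_eq_two_mul_of_compl (X : Finset V) :
    ∃ E : Finset (V × V), E.card = 2 * (X.card * Xᶜ.card) ∧
      ∀ p, p ∈ E ↔ ¬ (p.1 ∈ X ↔ p.2 ∈ X) := by
  refine ⟨X ×ˢ Xᶜ ∪ Xᶜ ×ˢ X, ?_, ?_⟩
  · rw [card_union_of_disjoint, card_product, card_product]
    · ring
    · rw [Finset.disjoint_left]
      rintro ⟨u, v⟩ h1 h2
      simp only [mem_product, mem_compl] at h1 h2
      exact h2.1 h1.1
  · rintro ⟨u, v⟩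
    simp only [mem_union, mem_product, mem_compl]
    tauto

lemma card_le_card_mul_card_compl {X : Finset V} (h1 : X.Nonempty) (h2 : Xᶜ.Nonempty) :
    Fintype.card V ≤ X.card * Xᶜ.card + 1 := by
  rw [← card_add_card_compl X]
  have := h1.card_pos
  have := h2.card_pos
  nlinarith

/-- The digons at `U` contribute `2 * U.card` to each cut that splits the complement of `U`. -/
lemma isEdgeConnected_hubDigraph {k : ℕ} (hk : U.card + 1 = k) (hn : k < Fintype.card V)
    (hU : ∀ i, h i ∉ U) (ha : ∀ i, a (h i) = i)
    (hb : ∀ i, b (h i) = i) (huniq : ∀ u ∉ U, a u = b u → u = h (a u))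
    (hpair : ∀ i j, i ≠ j → ∃ v ∉ U, a v = i ∧ b v = j) :
    IsEdgeConnected (2 * k) (underlyingMultigraph (hubDigraph U a b)) := by
  refine isEdgeConnected_of_cuts fun X hX hXc => ?_
  by_cases hsplit : (∃ p ∉ U, p ∈ X) ∧ ∃ q ∉ U, q ∉ X
  · obtain ⟨e₁, e₂, hne, he⟩ := exists_two_crossing_arcs hU ha hb huniq hpair X hsplit.1 hsplit.2
    obtain ⟨⟨p, hpU, hpX⟩, q, hqU, hqX⟩ := hsplit
    obtain ⟨y, hyU, hyX⟩ : ∃ y : V → V, (∀ z, y z ∉ U) ∧ ∀ z, ¬ (z ∈ X ↔ y z ∈ X) := by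
      refine ⟨fun z => if z ∈ X then q else p, fun z => ?_, fun z => ?_⟩
      · dsimp only; split_ifs <;> assumption
      · by_cases hz : z ∈ X <;> simp [hz, hpX, hqX]
    have hyne : ∀ z ∈ U, z ≠ y z := fun z hz h => hyU z (h ▸ hz)
    refine ⟨(U.image (fun z => (z, y z)) ∪ U.image fun z => (y z, z)) ∪ {e₁, e₂}, ?_, ?_⟩
    · rw [card_union_of_disjoint, card_union_of_disjoint, card_image_of_injective,
        card_image_of_injective, card_pair hne]
      · omega
      · exact fun z w h => (Prod.mk.inj h).2
      · exact fun z w h => (Prod.mk.inj h).1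
      · rw [Finset.disjoint_left]
        rintro ⟨u, v⟩ h1 h2
        simp only [mem_image, Prod.mk.injEq] at h1 h2
        obtain ⟨z, hz, rfl, -⟩ := h1
        obtain ⟨w, hw, hwz, -⟩ := h2
        exact hyU w (hwz ▸ hz)
      · rw [Finset.disjoint_left]
        intro e h1 h2
        have h3 := he e (by simpa using h2)
        simp only [mem_union, mem_image] at h1
        rcases h1 with ⟨z, hz, rfl⟩ | ⟨z, hz, rfl⟩
        · exact h3.2.2.1 hz
        · exact h3.2.2.2 hz
    · intro e h1
      rw [mem_union, mem_union, mem_image, mem_image] at h1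
      rcases h1 with (⟨z, hz, rfl⟩ | ⟨z, hz, rfl⟩) | h1
      · exact ⟨⟨hyne z hz, Or.inl hz⟩, hyX z⟩
      · exact ⟨⟨(hyne z hz).symm, Or.inr (Or.inl hz)⟩, fun h => hyX z h.symm⟩
      · have := he e (by simpa using h1)
        exact ⟨this.1, this.2.1⟩
  · have hor : X ⊆ U ∨ Xᶜ ⊆ U := by
      by_contra hcon
      rw [not_or, Finset.not_subset, Finset.not_subset] at hcon
      obtain ⟨⟨p, h1, h2⟩, q, h3, h4⟩ := hcon
      exact hsplit ⟨⟨p, h2, h1⟩, q, h4, by simpa using h3⟩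
    obtain ⟨E, hE, hmem⟩ := exists_card_eq_two_mul_of_compl X
    refine ⟨E, ?_, ?_⟩
    · have := card_le_card_mul_card_compl hX hXc
      omega
    · rintro ⟨u, v⟩ hp
      have hcross := (hmem _).1 hp
      refine ⟨⟨fun h => hcross (by simp only at h; simp [h]), ?_⟩, hcross⟩
      simp only at hcross ⊢
      by_cases hu : u ∈ X
      · have hv : v ∈ Xᶜ := by simp only [mem_compl]; tauto
        rcases hor with hor | hor
        · exact Or.inl (hor hu)
        · exact Or.inr (Or.inl (hor hv))
      · have hv : v ∈ X := by tauto
        rcases hor with hor | hor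
        · exact Or.inr (Or.inl (hor hv))
        · exact Or.inl (hor (by simpa using hu))

end Hubs

lemma exists_hard_digraph_of_four_le {k n : ℕ} (hk : 0 < k) (hn : k + 3 ≤ n) :
    ∃ D : Digraph (Fin n), IsLoopless D ∧ IsEdgeConnected (2 * k) (underlyingMultigraph D) ∧
      ∀ Xs, IsArcStrong k (invertFamily D Xs) → n - k + 1 ≤ 4 ^ Xs.length := by
  set m := Nat.sqrt (n - k + 1) with hm
  have hm1 : m * m ≤ n - k + 1 := Nat.sqrt_le _
  have hm2 : n - k + 1 < (m + 1) * (m + 1) := Nat.lt_succ_sqrt _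
  have hm3 : 2 ≤ m := by rw [hm, Nat.le_sqrt]; omega
  let i₀ : Fin m := ⟨0, by omega⟩
  let i₁ : Fin m := ⟨1, by omega⟩
  have hi : i₀ ≠ i₁ := by simp [i₀, i₁]
  -- the labelled pairs, surplus sinks, and the vertices of `U`
  let W := (Fin m × Fin m) ⊕ (Fin (n - k + 1 - m * m) ⊕ Fin (k - 1))
  obtain ⟨e⟩ : Nonempty (Fin n ≃ W) := ⟨Fintype.equivOfCardEq (by simp [W]; omega)⟩
  let lab : W → Fin m × Fin m := Sum.elim id fun _ => (i₀, i₁)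
  let U : Finset (Fin n) := univ.image fun z : Fin (k - 1) => e.symm (Sum.inr (Sum.inr z))
  let a : Fin n → Fin m := fun v => (lab (e v)).1
  let b : Fin n → Fin m := fun v => (lab (e v)).2
  let h : Fin m → Fin n := fun i => e.symm (Sum.inl (i, i))
  have hUcard : U.card + 1 = k := by
    have hinj : Function.Injective fun z : Fin (k - 1) => e.symm (Sum.inr (Sum.inr z)) :=
      e.symm.injective.comp (Sum.inr_injective.comp Sum.inr_injective)
    have hcard : U.card = Fintype.card (Fin (k - 1)) := card_image_of_injective univ hinj
    rw [Fintype.card_fin] at hcard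
    omega
  have hmemU : ∀ x, e.symm (Sum.inl x) ∉ U := fun x hx => by
    obtain ⟨z, -, hz⟩ := mem_image.1 hx
    simpa using e.symm.injective hz
  have hU : ∀ i, h i ∉ U := fun i => hmemU _
  have ha : ∀ i, a (h i) = i := fun i => by simp [a, h, lab]
  have hb : ∀ i, b (h i) = i := fun i => by simp [b, h, lab]
  have huniq : ∀ u ∉ U, a u = b u → u = h (a u) := by
    intro u _ hab
    obtain ⟨w, rfl⟩ := e.symm.surjective u
    rcases w with ⟨i, j⟩ | w
    · simp only [a, b, lab, Equiv.apply_symm_apply, Sum.elim_inl, id] at hab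
      subst hab
      simp [h, a, lab]
    · simp [a, b, lab, hi] at hab
  have hpair : ∀ i j, i ≠ j → ∃ v ∉ U, a v = i ∧ b v = j := fun i j _ =>
    ⟨e.symm (Sum.inl (i, j)), hmemU _, by simp [a, lab], by simp [b, lab]⟩
  have : Nontrivial (Fin m) := ⟨i₀, i₁, hi⟩
  refine ⟨hubDigraph U a b, fun v hv => hv.1 rfl,
    isEdgeConnected_hubDigraph hUcard (by simp; omega) hU ha hb huniq hpair, fun Xs hXs => ?_⟩
  have h1 := card_hubs_lt hUcard hU ha hb huniq hpair Xs hXs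
  rw [Fintype.card_fin] at h1
  calc n - k + 1 ≤ (m + 1) * (m + 1) := hm2.le
    _ ≤ 2 ^ Xs.length * 2 ^ Xs.length := Nat.mul_le_mul h1 h1
    _ = 4 ^ Xs.length := by rw [← mul_pow]; norm_num

/-- On `k + 2` vertices, a complete digraph with two arcs leaving the same vertex deleted is
`2k`-edge-connected but not `k`-arc-strong. -/
lemma exists_hard_digraph_of_eq {k n : ℕ} (hk : 0 < k) (hn : n = k + 2) :
    ∃ D : Digraph (Fin n), IsLoopless D ∧ IsEdgeConnected (2 * k) (underlyingMultigraph D) ∧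
      ∀ Xs, IsArcStrong k (invertFamily D Xs) → n - k + 1 ≤ 4 ^ Xs.length := by
  subst hn
  let x₀ : Fin (k + 2) := ⟨0, by omega⟩
  let x₁ : Fin (k + 2) := ⟨1, by omega⟩
  let x₂ : Fin (k + 2) := ⟨2, by omega⟩
  let D : Digraph (Fin (k + 2)) := ⟨fun u v => u ≠ v ∧ (u, v) ∉ ({(x₀, x₁), (x₀, x₂)} : Finset _)⟩
  refine ⟨D, fun v hv => hv.1 rfl, isEdgeConnected_of_cuts fun X hX hXc => ?_, fun Xs hXs => ?_⟩
  · obtain ⟨E, hE, hmem⟩ := exists_card_eq_two_mul_of_compl X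
    refine ⟨E \ {(x₀, x₁), (x₀, x₂)}, ?_, ?_⟩
    · have h1 := card_le_card_mul_card_compl hX hXc
      have h2 := le_card_sdiff {(x₀, x₁), (x₀, x₂)} E
      have h3 : ({(x₀, x₁), (x₀, x₂)} : Finset (Fin (k + 2) × Fin (k + 2))).card ≤ 2 :=
        card_le_two
      rw [Fintype.card_fin] at h1
      omega
    · rintro ⟨u, v⟩ hp
      rw [mem_sdiff] at hp
      have hcross := (hmem _).1 hp.1
      exact ⟨⟨fun h => hcross (by simp only at h; simp [h]), hp.2⟩, hcross⟩
  · rcases Xs with _ | ⟨X, Xs⟩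
    · exfalso
      have h10 : x₁ ≠ x₀ := by simp [x₀, x₁]
      have h20 : x₂ ≠ x₀ := by simp [x₀, x₂]
      have h12 : x₁ ≠ x₂ := by simp [x₁, x₂]
      have hcard : ({x₀, x₁, x₂}ᶜ : Finset (Fin (k + 2))).card + 1 = k := by
        rw [card_compl, Fintype.card_fin,
          card_eq_three.2 ⟨x₀, x₁, x₂, h10.symm, h20.symm, h12, rfl⟩]
        omega
      obtain ⟨y, hy, hxy⟩ := exists_arc_out hcard hXs (v := x₀) ⟨x₁, h10⟩
      have hxy : D.Adj x₀ y := hxy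
      simp only [mem_compl, mem_insert, mem_singleton, not_not] at hy
      rcases hy with rfl | rfl | rfl
      · exact hxy.1 rfl
      · exact hxy.2 (by simp)
      · exact hxy.2 (by simp)
    · rw [List.length_cons, pow_succ]
      have : 1 ≤ 4 ^ Xs.length := Nat.one_le_pow _ _ (by norm_num)
      omega

end LowerBound

lemma exists_hard_digraph {k n : ℕ} (hk : 0 < k) (hn : k + 2 ≤ n) :
    ∃ D : Digraph (Fin n), IsLoopless D ∧ IsEdgeConnected (2 * k) (underlyingMultigraph D) ∧
      ∀ Xs, IsArcStrong k (invertFamily D Xs) → n - k + 1 ≤ 4 ^ Xs.length := by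
  rcases hn.eq_or_lt with h | h
  · exact exists_hard_digraph_of_eq hk h.symm
  · exact exists_hard_digraph_of_four_le hk h

end ArcInversion

theorem mainTheorem1 (k n : ℕ) (hk : 0 < k) (hn : k + 2 ≤ n) :
    IsGreatest (ArcInversion.inversionNumbers k n)
        (ArcInversion.maxArcStrongInversionNumber k n) ∧
      ∃ m : ℕ, ArcInversion.maxArcStrongInversionNumber k n = (m : ℕ∞) ∧
        (1 / 2 : ℝ) * Real.logb 2 ((n : ℝ) - (k : ℝ) + 1) ≤ (m : ℝ) ∧
        (m : ℝ) ≤ Real.logb 2 (n : ℝ) + 4 * (k : ℝ) - 3 := by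
  open ArcInversion in
  have hbound : ∀ s ∈ inversionNumbers k n, s ≤ ((Nat.log 2 n + 4 * k - 3 : ℕ) : ℕ∞) := by
    rintro s ⟨D, h1, h2, rfl⟩
    obtain ⟨Xs, hlen, hXs⟩ := exists_inversions hk (by simpa using hn) h1 h2
    rw [Fintype.card_fin] at hlen
    exact (iInf₂_le Xs hXs).trans (by rw [hlen])
  obtain ⟨D, hD1, hD2, hD3⟩ := exists_hard_digraph hk hn
  have hDmem : arcStrongInversionNumber k D ∈ inversionNumbers k n := ⟨D, hD1, hD2, rfl⟩
  have hle : maxArcStrongInversionNumber k n ≤ ((Nat.log 2 n + 4 * k - 3 : ℕ) : ℕ∞) :=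
    sSup_le hbound
  have hlt : maxArcStrongInversionNumber k n < ⊤ := hle.trans_lt (ENat.natCast_lt_top _)
  have : Nonempty (inversionNumbers k n) := ⟨⟨_, hDmem⟩⟩
  refine ⟨⟨ENat.sSup_mem_of_nonempty_of_lt_top hlt, fun s hs => le_sSup hs⟩, ?_⟩
  obtain ⟨m, hm⟩ := ENat.ne_top_iff_exists.1 hlt.ne
  refine ⟨m, hm.symm, ?_, ?_⟩
  · have h1 : ((Nat.clog 4 (n - k + 1) : ℕ) : ℕ∞) ≤ arcStrongInversionNumber k D :=
      le_iInf₂ fun Xs hXs => by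
        exact_mod_cast (Nat.clog_le_iff_le_pow (by norm_num)).2 (hD3 Xs hXs)
    have h2 : ((Nat.clog 4 (n - k + 1) : ℕ) : ℕ∞) ≤ (m : ℕ∞) := by
      rw [hm]; exact h1.trans (le_sSup hDmem)
    have h3 : n - k + 1 ≤ 4 ^ m :=
      (Nat.clog_le_iff_le_pow (by norm_num)).1 (by exact_mod_cast h2)
    have h4 : (n : ℝ) - k + 1 ≤ 2 ^ (2 * m) := by
      rw [pow_mul]
      have : ((n - k + 1 : ℕ) : ℝ) ≤ ((4 ^ m : ℕ) : ℝ) := by exact_mod_cast h3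
      push_cast [Nat.cast_sub (show k ≤ n by omega)] at this
      norm_num at this ⊢
      linarith
    have h5 : (0 : ℝ) < (n : ℝ) - k + 1 := by
      have : (k : ℝ) ≤ n := by exact_mod_cast (show k ≤ n by omega)
      linarith
    have h6 := Real.logb_le_logb_of_le (b := 2) (by norm_num) h5 h4
    rw [Real.logb_pow, Real.logb_self_eq_one (by norm_num)] at h6
    push_cast at h6
    linarith
  · rw [← hm] at hle
    have h1 : m + 3 ≤ Nat.log 2 n + 4 * k := by
      have : m ≤ Nat.log 2 n + 4 * k - 3 := by exact_mod_cast hle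
      omega
    have h2 : ((m + 3 : ℕ) : ℝ) ≤ ((Nat.log 2 n + 4 * k : ℕ) : ℝ) := by exact_mod_cast h1
    have h3 := Real.natLog_le_logb n 2
    push_cast at h2 h3
    linarith
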